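/- Let $(C,o)\subset(\mathbb C^2,o)$ be a non-smooth irreducible plane curve singularity with local equation $f=0$ ($f\in\mathbb C\{x,y\}$ irreducible), local algebra $\mathcal O=\mathbb C\{x,y\}/(f)$ and normalization $n:(\mathbb C,0)\to(C,o)$, and let $\mathfrak v(h)=\operatorname{ord}_t(n^*h)\in\mathbb N\cup\{\infty\}$ for $h\in\mathcal O$. *Semigroup data.* Let $\mathcal S=\mathfrak v(\mathcal O)\cap\mathbb N$ be the semigroup of values, let $\beta_0<\dots<\beta_g$ be its minimal generators, and put $l_{g-1}=\gcd(\beta_0,\dots,\beta_{g-1})$, $\delta=\#(\mathbb N\setminus\mathcal S)$. The multiplicity is $m=\min(\mathcal S\setminus\{0\})$. *Lattice cohomology.* Let $w_0(\ell)=2\dim_{\mathbb C}\mathcal O/\{h:\mathfrak v(h)\ge\ell\}-\ell$ for $\ell\in\mathbb N$, let $w(x)=\max\{w_0(\lfloor x\rfloor),w_0(\lceil x\rceil)\}$ for real $x\ge0$, and $S_n=\{x\ge 0: w(x)\le n\}$ for $n\in\mathbb Z$. Put $\mathbb H^0=\bigoplus_{n\in\mathbb Z}\mathbb H^0_{2n}$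 with $\mathbb H^0_{2n}=H^0(S_n,\mathbb Z)$, and let $U:\mathbb H^0_{2n}\to\mathbb H^0_{2n-2}$ be the restriction map. Let $T^\infty\subseteq\mathbb H^0$ be the $\mathbb Z[U]$-submodule generated by $\bigoplus_{n>0}\mathbb H^0_{2n}$. *Graded root.* Let $R$ be the graph whose vertices of grading $\chi=n$ are the connected components of $S_n$, a component of $S_n$ being joined to the component of $S_{n+1}$ that contains it. A local minimum of $R$ is a vertex whose grading is smaller than that of each of its neighbours; a leaf of a graph is a vertex with exactly one neighbour; the trimmed root $\overline R$ is $R$ with all its leaves removed. The following conditions are equivalent: 1. $l_{g-1}=2$; 2. $\min w_0$ is even and $\operatorname{rank}_{\mathbb Z}\mathbb H^0_{4k+2}=1$ for all integers $k\ge(\min w_0)/2$; 3. all local minima of $R$ have even grading and $\overline R$ has exactly one leaf; 4. $\beta_g>\delta$ and $m\ne3$. Moreover, condition 2 implies that $U\cdot\mathbb H^0\subseteq T^\infty$ and that, if $0\neq\alpha\in\mathbb H^0_{2n}$ satisfies $U\alpha=0$, then $n$ is even. -/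

import Mathlib

open Topology

noncomputable section

namespace PlaneCurve

/-! ## Germs of holomorphic functions -/

/-- Functions `E → ℂ` that are holomorphic near the origin. -/
def analyticFunctions (E : Type) [NormedAddCommGroup E] [NormedSpace ℂ E] :
    Subalgebra ℂ (E → ℂ) where
  carrier := {f | AnalyticAt ℂ f 0}
  mul_mem' hf hg := AnalyticAt.mul hf hg
  add_mem' hf hg := AnalyticAt.add hf hg
  algebraMap_mem' c := (analyticAt_const : AnalyticAt ℂ (fun _ : E => c) 0)

/-- The ideal of those functions that vanish identically near the origin. -/
def vanishingNearZero (E : Type) [NormedAddCommGroup E] [NormedSpace ℂ E] :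
    Ideal (analyticFunctions E) where
  carrier := {f | ∀ᶠ x in 𝓝 (0 : E), f.1 x = 0}
  zero_mem' := Filter.Eventually.of_forall fun _ => rfl
  add_mem' {f g} hf hg := by
    filter_upwards [hf, hg] with x h1 h2
    change f.1 x + g.1 x = 0
    rw [h1, h2, add_zero]
  smul_mem' g f hf := by
    filter_upwards [hf] with x h1
    change g.1 x * f.1 x = 0
    rw [h1, mul_zero]

/-- The local algebra of germs at the origin of holomorphic functions on `E`, that is,
convergent power series: `ℂ{x, y}` for `E = ℂ × ℂ` and `ℂ{t}` for `E = ℂ`. -/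
def HolGerm (E : Type) [NormedAddCommGroup E] [NormedSpace ℂ E] : Type :=
  analyticFunctions E ⧸ vanishingNearZero E

instance (E : Type) [NormedAddCommGroup E] [NormedSpace ℂ E] : CommRing (HolGerm E) :=
  Ideal.Quotient.commRing (vanishingNearZero E)

instance (E : Type) [NormedAddCommGroup E] [NormedSpace ℂ E] : Algebra ℂ (HolGerm E) :=
  Ideal.Quotient.algebra ℂ

/-- The quotient map from holomorphic functions to germs. -/
def toGerm (E : Type) [NormedAddCommGroup E] [NormedSpace ℂ E] :
    analyticFunctions E →ₐ[ℂ] HolGerm E :=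
  Ideal.Quotient.mkₐ ℂ (vanishingNearZero E)

theorem toGerm_surjective (E : Type) [NormedAddCommGroup E] [NormedSpace ℂ E] :
    Function.Surjective (toGerm E) :=
  Ideal.Quotient.mk_surjective

theorem toGerm_eq_zero_iff {E : Type} [NormedAddCommGroup E] [NormedSpace ℂ E]
    (f : analyticFunctions E) : toGerm E f = 0 ↔ ∀ᶠ x in 𝓝 (0 : E), f.1 x = 0 :=
  Ideal.Quotient.eq_zero_iff_mem (I := vanishingNearZero E)

/-- The germ at the origin of a holomorphic function. -/
def germ {E : Type} [NormedAddCommGroup E] [NormedSpace ℂ E] (f : E → ℂ)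
    (hf : AnalyticAt ℂ f 0) : HolGerm E :=
  toGerm E ⟨f, hf⟩

/-- The order of vanishing `ord_t : ℂ{t} → ℕ ∪ {∞}`. -/
def ordGerm (g : HolGerm ℂ) : ℕ∞ :=
  Quotient.liftOn' g (fun f => analyticOrderAt f.1 0) (by
    intro f g hfg
    have h : f - g ∈ vanishingNearZero ℂ := (Submodule.quotientRel_def _).1 hfg
    refine analyticOrderAt_congr ?_
    have h' : ∀ᶠ x in 𝓝 (0 : ℂ), f.1 x - g.1 x = 0 := h
    filter_upwards [h'] with x hx
    exact sub_eq_zero.1 hx)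

theorem ordGerm_mk (f : analyticFunctions ℂ) :
    ordGerm (toGerm ℂ f) = analyticOrderAt f.1 0 := rfl

theorem ordGerm_zero : ordGerm 0 = ⊤ := by
  rw [← map_zero (toGerm ℂ), ordGerm_mk, analyticOrderAt_eq_top]
  exact Filter.Eventually.of_forall fun _ => rfl

theorem ordGerm_one : ordGerm 1 = 0 := by
  rw [← map_one (toGerm ℂ), ordGerm_mk, analyticOrderAt_eq_zero]
  exact Or.inr one_ne_zero

theorem ordGerm_mul (a b : HolGerm ℂ) : ordGerm (a * b) = ordGerm a + ordGerm b := by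
  obtain ⟨f, rfl⟩ := toGerm_surjective ℂ a
  obtain ⟨g, rfl⟩ := toGerm_surjective ℂ b
  rw [← map_mul, ordGerm_mk, ordGerm_mk, ordGerm_mk]
  exact analyticOrderAt_mul f.2 g.2

theorem le_ordGerm_add (a b : HolGerm ℂ) : min (ordGerm a) (ordGerm b) ≤ ordGerm (a + b) := by
  obtain ⟨f, rfl⟩ := toGerm_surjective ℂ a
  obtain ⟨g, rfl⟩ := toGerm_surjective ℂ b
  rw [← map_add, ordGerm_mk, ordGerm_mk, ordGerm_mk]
  exact le_analyticOrderAt_add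

/-! ## Irreducible plane curve germs and their normalization -/

/-- An irreducible plane curve germ `(C, o) ⊂ (ℂ², o)`, given by an irreducible local equation
`f = 0` (irreducibility entails that `f` is nonzero and vanishes at the origin). -/
structure IrredGerm where
  f : ℂ × ℂ → ℂ
  analytic : AnalyticAt ℂ f 0
  irreducible : Irreducible (germ f analytic)

/-- The local algebra `𝒪 = ℂ{x, y} / (f)`. -/
def IrredGerm.LocalRing (C : IrredGerm) : Type :=
  HolGerm (ℂ × ℂ) ⧸ Ideal.span {germ C.f C.analytic}

instance (C : IrredGerm) : CommRing C.LocalRing :=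
  Ideal.Quotient.commRing (Ideal.span {germ C.f C.analytic})

instance (C : IrredGerm) : Algebra ℂ C.LocalRing :=
  Ideal.Quotient.algebra ℂ

/-- The germ is smooth if some first partial derivative of its reduced equation is nonzero
at the origin. -/
def IrredGerm.IsSmooth (C : IrredGerm) : Prop := fderiv ℂ C.f 0 ≠ 0

/-- A holomorphic map germ `n : (ℂ, 0) → (C, o)`. -/
structure Arc (C : IrredGerm) where
  n : ℂ → ℂ × ℂ
  analytic : AnalyticAt ℂ n 0
  map_zero : n 0 = 0
  mem_curve : ∀ᶠ t in 𝓝 (0 : ℂ), C.f (n t) = 0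

namespace Arc

variable {C : IrredGerm} (γ : Arc C)

/-- Composition with `n`, on functions. -/
def compFun : analyticFunctions (ℂ × ℂ) →ₐ[ℂ] analyticFunctions ℂ where
  toFun F := ⟨fun t => F.1 (γ.n t), AnalyticAt.comp_of_eq F.2 γ.analytic γ.map_zero⟩
  map_one' := rfl
  map_mul' _ _ := rfl
  map_zero' := rfl
  map_add' _ _ := rfl
  commutes' _ := rfl

/-- Composition with `n`, as a map of germs `ℂ{x, y} → ℂ{t}`. -/
def pullbackAmbient : HolGerm (ℂ × ℂ) →ₐ[ℂ] HolGerm ℂ :=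
  Ideal.quotientMapₐ (vanishingNearZero ℂ) γ.compFun (by
    intro F hF
    have h : ∀ᶠ x in 𝓝 (0 : ℂ × ℂ), F.1 x = 0 := hF
    have ht : Filter.Tendsto γ.n (𝓝 0) (𝓝 0) := by
      have := γ.analytic.continuousAt.tendsto
      rwa [γ.map_zero] at this
    exact ht.eventually h)

/-- The pull-back of functions `n^* : 𝒪 → ℂ{t}`. -/
def pullback : C.LocalRing →ₐ[ℂ] HolGerm ℂ :=
  Ideal.Quotient.liftₐ (Ideal.span {germ C.f C.analytic}) γ.pullbackAmbient (by
    intro a ha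
    obtain ⟨b, rfl⟩ := Ideal.mem_span_singleton'.1 ha
    have h : γ.pullbackAmbient (germ C.f C.analytic) = 0 :=
      (toGerm_eq_zero_iff (E := ℂ) _).2 γ.mem_curve
    rw [map_mul, h, mul_zero])

/-- `n` is the normalization of `(C, o)`: via `n^*`, the (integrally closed) ring `ℂ{t}` is an
integral extension of `𝒪` inside the fraction field of `𝒪`. -/
structure IsNormalization : Prop where
  injective : Function.Injective γ.pullback
  integral : γ.pullback.toRingHom.IsIntegral
  birational : ∀ b : HolGerm ℂ, ∃ p q : C.LocalRing,
    γ.pullback q ≠ 0 ∧ γ.pullback q * b = γ.pullback p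

/-- The valuation `𝔳 : 𝒪 → ℕ ∪ {∞}`, `g ↦ ord_t (n^* g)`. -/
def val (g : C.LocalRing) : ℕ∞ := ordGerm (γ.pullback g)

/-- The filtration `ℱ(ℓ) = {g ∈ 𝒪 | 𝔳(g) ≥ ℓ}`. -/
def filtration (l : ℕ) : Ideal C.LocalRing where
  carrier := {g | (l : ℕ∞) ≤ γ.val g}
  zero_mem' := by
    change (l : ℕ∞) ≤ ordGerm (γ.pullback 0)
    rw [_root_.map_zero, ordGerm_zero]
    exact le_top
  add_mem' {a b} ha hb := by
    change (l : ℕ∞) ≤ ordGerm (γ.pullback (a + b))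
    rw [map_add]
    exact (le_min ha hb).trans (le_ordGerm_add _ _)
  smul_mem' c a ha := by
    change (l : ℕ∞) ≤ ordGerm (γ.pullback (c * a))
    rw [map_mul, ordGerm_mul]
    exact le_trans ha le_add_self

/-- The Hilbert function `𝔥(ℓ) = dim_ℂ 𝒪 / ℱ(ℓ)`. -/
def hilbert (l : ℕ) : ℕ := Module.finrank ℂ (C.LocalRing ⧸ γ.filtration l)

/-- The weight function `w₀(ℓ) = 2 𝔥(ℓ) - ℓ`. -/
def w0 (l : ℕ) : ℤ := 2 * (γ.hilbert l : ℤ) - (l : ℤ)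

/-- The semigroup of values `𝒮 = {𝔳(g) | g ∈ 𝒪} ∩ ℕ`. -/
def semigroup : AddSubmonoid ℕ where
  carrier := {s | ∃ g : C.LocalRing, γ.val g = (s : ℕ∞)}
  zero_mem' := ⟨1, by rw [val, map_one, ordGerm_one]; rfl⟩
  add_mem' := by
    rintro a b ⟨g, hg⟩ ⟨h, hh⟩
    refine ⟨g * h, ?_⟩
    rw [val, map_mul, ordGerm_mul]
    change γ.val g + γ.val h = _
    rw [hg, hh, Nat.cast_add]

end Arc

/-! ## Numerical semigroups -/

/-- The elements of `S \ {0}` that are not a sum of two elements of `S \ {0}`. -/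
def minimalGenerators (S : AddSubmonoid ℕ) : Set ℕ :=
  {s | s ∈ S ∧ s ≠ 0 ∧ ¬ ∃ a ∈ S, ∃ b ∈ S, a ≠ 0 ∧ b ≠ 0 ∧ a + b = s}

/-- `minimalGenerators S` generates `S`. -/
theorem closure_minimalGenerators (S : AddSubmonoid ℕ) :
    AddSubmonoid.closure (minimalGenerators S) = S := by
  apply le_antisymm
  · exact (AddSubmonoid.closure_le).2 fun s hs => hs.1
  · intro s
    induction s using Nat.strong_induction_on with
    | _ s ih =>
      intro hs
      by_cases h0 : s = 0
      · rw [h0]; exact zero_mem _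
      by_cases h : ∃ a ∈ S, ∃ b ∈ S, a ≠ 0 ∧ b ≠ 0 ∧ a + b = s
      · obtain ⟨a, ha, b, hb, ha0, hb0, hab⟩ := h
        rw [← hab]
        exact add_mem (ih a (by omega) ha) (ih b (by omega) hb)
      · exact AddSubmonoid.subset_closure ⟨hs, h0, h⟩

/-- `minimalGenerators S` is contained in every generating set of `S`; together with the previous
fact, it is the unique minimal generating set of `S`. -/
theorem minimalGenerators_subset (S : AddSubmonoid ℕ) (B : Set ℕ)
    (hB : AddSubmonoid.closure B = S) : minimalGenerators S ⊆ B := by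
  rintro s ⟨hs, h0, h⟩
  have key : ∀ x ∈ AddSubmonoid.closure B, x ≠ 0 →
      x ∈ B ∨ ∃ a ∈ S, ∃ b ∈ S, a ≠ 0 ∧ b ≠ 0 ∧ a + b = x := by
    intro x hx
    induction hx using AddSubmonoid.closure_induction with
    | mem x hx => exact fun _ => Or.inl hx
    | zero => exact fun h => absurd rfl h
    | add x y hx hy ihx ihy =>
      intro hxy
      by_cases hx0 : x = 0
      · subst hx0; simpa using ihy (by simpa using hxy)
      by_cases hy0 : y = 0
      · subst hy0; simpa using ihx hx0
      exact Or.inr ⟨x, hB ▸ hx, y, hB ▸ hy, hx0, hy0, rfl⟩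
  exact (key s (hB ▸ hs) h0).resolve_right h

/-- The index `g`, where `β₀ < ⋯ < β_g` are the minimal generators of `S`. -/
def lastIndex (S : AddSubmonoid ℕ) : ℕ := (minimalGenerators S).ncard - 1

/-- The `i`-th minimal generator `β_i` in increasing order (meaningful for `i ≤ g`). -/
def beta (S : AddSubmonoid ℕ) (i : ℕ) : ℕ := Nat.nth (· ∈ minimalGenerators S) i

/-- `l_i = gcd(β₀, …, β_i)`. -/
def gcdBeta (S : AddSubmonoid ℕ) (i : ℕ) : ℕ := (Finset.range (i + 1)).gcd (beta S)

/-- The multiplicity `min (S \ {0})`. -/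
def multiplicity (S : AddSubmonoid ℕ) : ℕ := sInf {s | s ∈ S ∧ s ≠ 0}

/-- The delta invariant `#(ℕ \ S)`. -/
def delta (S : AddSubmonoid ℕ) : ℕ := ((S : Set ℕ)ᶜ).ncard

/-! ## Lattice cohomology

The curve is irreducible, so the lattice is `ℕ ⊂ ℝ_{≥0}` and only `ℍ⁰` is needed. -/

section Lattice

variable (w₀ : ℕ → ℤ)

/-- The extended weight function. -/
def extWeight (x : ℝ) : ℤ := max (w₀ ⌊x⌋₊) (w₀ ⌈x⌉₊)

/-- The sublevel set `S_n ⊂ ℝ_{≥0}`. -/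
def sublevel (n : ℤ) : Set ℝ := {x | 0 ≤ x ∧ extWeight w₀ x ≤ n}

theorem sublevel_mono {m n : ℤ} (h : m ≤ n) : sublevel w₀ m ⊆ sublevel w₀ n :=
  fun _ hx => ⟨hx.1, hx.2.trans h⟩

/-- The group `ℍ⁰_{2n} = H⁰(S_n, ℤ)`: locally constant functions `S_n → ℤ`.
Note that `n` is half of the grading. -/
abbrev H0 (n : ℤ) : Type := LocallyConstant (sublevel w₀ n) ℤ

/-- Restriction `H⁰(S_n, ℤ) → H⁰(S_m, ℤ)` along the inclusion `S_m ⊆ S_n`. -/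
def restrict {m n : ℤ} (h : m ≤ n) : H0 w₀ n →ₗ[ℤ] H0 w₀ m :=
  LocallyConstant.comapₗ ℤ
    ⟨Set.inclusion (sublevel_mono w₀ h), continuous_inclusion (sublevel_mono w₀ h)⟩

/-- The module `ℍ⁰ = ⨁_n ℍ⁰_{2n}`. -/
abbrev LatticeH0 : Type := DirectSum ℤ (H0 w₀)

/-- The inclusion of the homogeneous part `ℍ⁰_{2n}` into `ℍ⁰`. -/
def homog (n : ℤ) : H0 w₀ n →ₗ[ℤ] LatticeH0 w₀ := DirectSum.lof ℤ ℤ (H0 w₀) n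

/-- The action of `U`, mapping `ℍ⁰_{2n}` to `ℍ⁰_{2n-2}` by restriction. -/
def actU : LatticeH0 w₀ →ₗ[ℤ] LatticeH0 w₀ :=
  DirectSum.toModule ℤ ℤ (LatticeH0 w₀) fun n =>
    (homog w₀ (n - 1)).comp (restrict w₀ (sub_le_self n zero_le_one))

/-- The canonical `ℤ[U]`-submodule `T^∞ ⊆ ℍ⁰` generated by `⨁_{n > 0} ℍ⁰_{2n}`: the smallest
subgroup that contains these summands and is stable under `U`. -/
def towerSubmodule : Submodule ℤ (LatticeH0 w₀) :=
  sInf {N | (∀ n : ℤ, 0 < n → LinearMap.range (homog w₀ n) ≤ N) ∧ N ≤ N.comap (actU w₀)}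

/-! ## The graded root -/

/-- A vertex of the graded root: a connected component of some `S_n`, with `χ = n`. -/
@[ext] structure RootVertex where
  chi : ℤ
  comp : Set ℝ
  isComp : ∃ x ∈ sublevel w₀ chi, comp = connectedComponentIn (sublevel w₀ chi) x

/-- The graded root: a component of `S_n` is joined to the component of `S_{n+1}` containing it. -/
def gradedRoot : SimpleGraph (RootVertex w₀) where
  Adj u v := (v.chi = u.chi + 1 ∧ u.comp ⊆ v.comp) ∨ (u.chi = v.chi + 1 ∧ v.comp ⊆ u.comp)
  symm := ⟨fun _ _ h => h.symm⟩
  loopless := ⟨fun u h => by rcases h with h | h <;> omega⟩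

/-- A local minimum point of the graded root. -/
def IsLocalMin (v : RootVertex w₀) : Prop :=
  ∀ u : RootVertex w₀, (gradedRoot w₀).Adj v u → v.chi < u.chi

end Lattice

/-- A leaf of a graph is a vertex with exactly one neighbour. -/
def IsLeaf {V : Type} (G : SimpleGraph V) (v : V) : Prop := ∃! u, G.Adj v u

/-- The trimmed graph, obtained by removing all leaves. -/
def trim {V : Type} (G : SimpleGraph V) : SimpleGraph {v : V // ¬ IsLeaf G v} :=
  G.comap Subtype.val

/-! ## The conditions -/

/-- `min w₀` is even, and `rank ℍ⁰_{4k+2} = 1` for all integers `k ≥ min w₀ / 2`. -/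
def OddRanksOne (w₀ : ℕ → ℤ) : Prop :=
  ∃ m : ℤ, IsLeast (Set.range w₀) m ∧ Even m ∧
    ∀ k : ℤ, m ≤ 2 * k → Module.finrank ℤ (H0 w₀ (2 * k + 1)) = 1

/-- All local minima of the graded root have even grading, and the trimmed root has exactly
one leaf. -/
def RootEvenTrimmedPath (w₀ : ℕ → ℤ) : Prop :=
  (∀ v : RootVertex w₀, IsLocalMin w₀ v → Even v.chi) ∧
    ∃! v : {v : RootVertex w₀ // ¬ IsLeaf (gradedRoot w₀) v}, IsLeaf (trim (gradedRoot w₀)) v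

end PlaneCurve

end

/-! Let `x` be a coordinate of least order `m` on the branch and `y` the other one. Values of
functions are values of polynomials in `y` over `ℂ[x]`. For `i < m` let `a i` be the largest order
of a monic polynomial of degree `i`. Two of these maxima cannot agree modulo `m`, since a leading
term could then be cancelled, so they form the Apéry sequence of `𝒮`. Products of monic polynomials
are monic, whence `a i + a j ≤ a (i + j)` (`exists_isAperySeq`). All that is needed about `𝒮`
follows from this superadditivity.

Let `D` be the last index for which `a D` is not `a i + a j` with `i, j > 0` and `i + j = D`. A
pigeonhole argument (`residues_add_mem`) shows that the classes of `a 0, …, a (D - 1)` form a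
subgroup of `ℤ/m`, of order `D`. Hence `β_g = a D` and `l_{g-1} = m / D`. Comparing sums over the
Apéry sequence gives its symmetry, so `𝒮` is symmetric with conductor `c = 2δ`.

The weight rises by one at elements of `𝒮` and falls by one at gaps, so `w₀ l` has the parity of
`l`. If `m / D = 2`, the odd elements of `𝒮` start at `β_g`, and all even numbers from `β_g - 1` on
belong to `𝒮`. So odd steps descend before `β_g` and even steps ascend from `β_g - 1` on, which
makes every sublevel set of odd height an interval; both lattice conditions follow. Moreover `c <
2β_g`.

If `m / D ≠ 2`, then `m / D ≥ 3`, and superadditivity gives `2β_g < c` unless `m = 3`. Let `s` be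
the least odd element of `𝒮`; then `s ≤ β_g`. If `s - 1` is a gap (as it is for `m = 3`), then `s`
is a valley of odd weight. Otherwise `w₀` climbs by two from `s - 1` to `s + 1`, and by symmetry it
returns to `w₀ (s - 1)` at `c - (s - 1) > s + 1`, so an odd sublevel set is disconnected. Each
configuration violates both lattice conditions (`not_of_gcdBeta_ne_two`).

Under condition 2 all classes of odd `n` are constant, and of two consecutive levels one is odd;
this yields the statements on `U`. -/

noncomputable section

namespace PlaneCurve

/-! ## Numerical semigroups with a superadditive Apéry sequence -/

/-- The semigroup `S` has the Apéry sequence `0 = a 0 < a 1 < ⋯ < a (m - 1)` with respect to `m`,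
and this sequence is superadditive. -/
structure IsAperySeq (S : AddSubmonoid ℕ) (m : ℕ) (a : ℕ → ℕ) : Prop where
  one_lt : 1 < m
  zero : a 0 = 0
  lt_one : m < a 1
  superadd : ∀ i j, i + j < m → a i + a j ≤ a (i + j)
  mem_iff : ∀ s, s ∈ S ↔ ∃ i < m, ∃ k, s = a i + m * k
  inj : ∀ i < m, ∀ j < m, (a i : ZMod m) = a j → i = j

/-- The residue classes of the first `D` elements of a sequence. -/
def residues (m : ℕ) (a : ℕ → ℕ) (D : ℕ) : Finset (ZMod m) :=
  (Finset.range D).image fun i => (a i : ZMod m)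

theorem mem_residues {m : ℕ} {a : ℕ → ℕ} {D : ℕ} {x : ZMod m} :
    x ∈ residues m a D ↔ ∃ i < D, (a i : ZMod m) = x := by
  simp [residues]

/-- `a D` is a sum of two earlier elements with complementary indices. -/
def IsDecomposable (a : ℕ → ℕ) (D : ℕ) : Prop :=
  ∃ i j, 0 < i ∧ 0 < j ∧ i + j = D ∧ a D = a i + a j

namespace IsAperySeq

variable {S : AddSubmonoid ℕ} {m : ℕ} {a : ℕ → ℕ}

theorem mem (h : IsAperySeq S m a) {i : ℕ} (hi : i < m) : a i ∈ S :=
  (h.mem_iff _).2 ⟨i, hi, 0, by simp⟩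

theorem mult_mem (h : IsAperySeq S m a) : m ∈ S :=
  (h.mem_iff _).2 ⟨0, by have := h.one_lt; omega, 1, by simp [h.zero]⟩

/-- Superadditivity gives `a j - a i ≥ a (j - i) ≥ a 1 > m`. Thus the sequence increases, with gaps
larger than `m`. -/
theorem add_lt (h : IsAperySeq S m a) {i j : ℕ} (hij : i < j) (hj : j < m) : a i + m < a j := by
  have h1 := h.superadd i (j - i) (by omega)
  have h2 := h.superadd 1 (j - i - 1) (by omega)
  have h3 := h.lt_one
  rw [show i + (j - i) = j by omega] at h1
  rw [show 1 + (j - i - 1) = j - i by omega] at h2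
  omega

theorem mono (h : IsAperySeq S m a) {i j : ℕ} (hij : i ≤ j) (hj : j < m) : a i ≤ a j := by
  rcases hij.eq_or_lt with rfl | hlt
  · exact le_rfl
  · have := h.add_lt hlt hj
    omega

theorem lt_iff (h : IsAperySeq S m a) {i j : ℕ} (hi : i < m) (hj : j < m) :
    a i < a j ↔ i < j := by
  constructor
  · intro hlt
    by_contra hc
    have := h.mono (not_lt.1 hc) hi
    omega
  · intro hlt
    have := h.add_lt hlt hj
    omega

theorem le_of_mem (h : IsAperySeq S m a) {s i : ℕ} (hs : s ∈ S) (hi : i < m)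
    (hc : (s : ZMod m) = a i) : a i ≤ s := by
  obtain ⟨j, hj, k, rfl⟩ := (h.mem_iff _).1 hs
  have : j = i := h.inj j hj i hi (by simpa using hc)
  subst this
  omega

theorem mem_of_le (h : IsAperySeq S m a) {s i : ℕ} (hi : i < m)
    (hc : (s : ZMod m) = a i) (hle : a i ≤ s) : s ∈ S := by
  have hd : m ∣ s - a i := by
    rw [← Nat.modEq_iff_dvd' hle]
    exact ((ZMod.natCast_eq_natCast_iff _ _ _).1 hc).symm
  obtain ⟨k, hk⟩ := hd
  exact (h.mem_iff _).2 ⟨i, hi, k, by omega⟩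

theorem exists_index (h : IsAperySeq S m a) (x : ZMod m) : ∃ i < m, x = a i := by
  have : NeZero m := ⟨by have := h.one_lt; omega⟩
  have hinj : Function.Injective fun i : Fin m => (a i : ZMod m) :=
    fun i j hij => Fin.ext (h.inj i i.2 j j.2 hij)
  have hsurj := ((Fintype.bijective_iff_injective_and_card _).2 ⟨hinj, by simp⟩).2
  obtain ⟨i, hi⟩ := hsurj x
  exact ⟨i, i.2, hi.symm⟩

theorem card_residues (h : IsAperySeq S m a) {D : ℕ} (hD : D ≤ m) :
    (residues m a D).card = D := by
  rw [residues, Finset.card_image_of_injOn, Finset.card_range]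
  intro i hi j hj hij
  simp only [Finset.coe_range, Set.mem_Iio] at hi hj
  exact h.inj i (by omega) j (by omega) hij

theorem zero_mem_residues (h : IsAperySeq S m a) {D : ℕ} (hD : 0 < D) :
    (0 : ZMod m) ∈ residues m a D :=
  mem_residues.2 ⟨0, hD, by simp [h.zero]⟩

/-- The Apéry element `a k` in the class of the sum satisfies `a k ≤ a i + a j ≤ a (i + j)`, so `k ≤
i + j` because the sequence increases. -/
theorem add_mem_residues (h : IsAperySeq S m a) {i j : ℕ} (hij : i + j < m) :
    (a i + a j : ZMod m) ∈ residues m a (i + j + 1) := by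
  obtain ⟨k, hk, hk'⟩ := h.exists_index (a i + a j : ZMod m)
  have h1 : a k ≤ a i + a j :=
    h.le_of_mem (S.add_mem (h.mem (by omega)) (h.mem (by omega))) hk (by simpa using hk')
  have h2 := h.superadd i j hij
  have h3 : k ≤ i + j := by
    by_contra hc
    have := h.add_lt (not_le.1 hc) hk
    omega
  exact mem_residues.2 ⟨k, by omega, hk'.symm⟩

theorem isDecomposable_of_add_eq (h : IsAperySeq S m a) {i j : ℕ} (hi : 0 < i) (hj : 0 < j)
    (hij : i + j < m) (he : (a i + a j : ZMod m) = a (i + j)) : IsDecomposable a (i + j) :=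
  ⟨i, j, hi, hj, rfl, le_antisymm
    (h.le_of_mem (S.add_mem (h.mem (by omega)) (h.mem (by omega))) hij (by simpa using he))
    (h.superadd i j hij)⟩

/-- If `a D` is not decomposable, then the residues of the elements before `a D` are closed under
addition. -/
theorem residues_add_mem (h : IsAperySeq S m a) (D : ℕ) (hD : D < m)
    (hdec : ¬ IsDecomposable a D) :
    ∀ x ∈ residues m a D, ∀ y ∈ residues m a D, x + y ∈ residues m a D := by
  induction D using Nat.strong_induction_on with
  | _ D ihD =>
  -- Inner induction on `i`: translation by `a i` preserves the first `D` classes.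
  have key : ∀ i < D, ∀ y ∈ residues m a D, (a i : ZMod m) + y ∈ residues m a D := by
    intro i
    induction i using Nat.strong_induction_on with
    | _ i ih =>
    intro hi y hy
    rcases Nat.eq_zero_or_pos i with rfl | hi0
    · simpa [h.zero] using hy
    by_cases hdi : IsDecomposable a i
    · obtain ⟨p, q, hp, hq, hpq, he⟩ := hdi
      rw [he, Nat.cast_add, add_assoc]
      exact ih p (by omega) (by omega) _ (ih q (by omega) (by omega) y hy)
    -- The outer induction applies to the indecomposable index `i`: the first `i` classes are closed
    -- under addition, hence form a subgroup, which acts on the first `D` classes by `hstable`.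
    have hsub := ihD i hi (by omega) hdi
    have hstable : ∀ z ∈ residues m a i, ∀ y ∈ residues m a D, z + y ∈ residues m a D := by
      intro z hz y hy
      obtain ⟨p, hp, rfl⟩ := mem_residues.1 hz
      exact ih p hp (by omega) y hy
    have hneg : ∀ z ∈ residues m a i, -z ∈ residues m a i := by
      intro z hz
      have hn : ∀ n : ℕ, n • z ∈ residues m a i := by
        intro n
        induction n with
        | zero => simpa using h.zero_mem_residues hi0
        | succ n ihn => rw [succ_nsmul]; exact hsub _ ihn _ hz
      have : -z = (m - 1) • z := by
        have h1 := h.one_lt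
        rw [nsmul_eq_mul, Nat.cast_sub (by omega)]
        simp
      rw [this]
      exact hn _
    -- The sum has index at most `i + j ≤ D`; index `D` itself would decompose `a D`.
    have hsmall : ∀ j ≤ D - i, (a i + a j : ZMod m) ∈ residues m a D := by
      intro j hj
      rcases Nat.eq_zero_or_pos j with rfl | hj0
      · exact mem_residues.2 ⟨i, hi, by simp [h.zero]⟩
      obtain ⟨k, hk, hk'⟩ := mem_residues.1 (h.add_mem_residues (i := i) (j := j) (by omega))
      rcases (show k < D ∨ k = i + j ∧ i + j = D by omega) with hkD | ⟨rfl, hkD⟩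
      · exact mem_residues.2 ⟨k, hkD, hk'⟩
      · exact absurd (hkD ▸ h.isDecomposable_of_add_eq hi0 hj0 (by omega) hk'.symm) hdec
    -- Pigeonhole: the coset of `y` has `i` elements among the first `D` classes, but only `i - 1`
    -- indices lie strictly between `D - i` and `D`.
    have hcoset : ∃ z ∈ residues m a i, ∃ j ≤ D - i, y + z = a j := by
      by_contra hc
      push Not at hc
      have hsubset : (residues m a i).image (fun z => y + z) ⊆
          (Finset.Ioo (D - i) D).image fun j => (a j : ZMod m) := by
        intro w hw
        obtain ⟨z, hz, rfl⟩ := Finset.mem_image.1 hw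
        obtain ⟨j, hj, hj'⟩ := mem_residues.1 (hstable z hz y hy)
        have h3 : ¬ j ≤ D - i := fun hle => hc z hz j hle (by rw [hj', add_comm])
        exact Finset.mem_image.2 ⟨j, Finset.mem_Ioo.2 ⟨by omega, hj⟩, by rw [hj', add_comm]⟩
      have h1 := Finset.card_le_card hsubset
      rw [Finset.card_image_of_injective _ (add_right_injective y), h.card_residues (by omega)] at h1
      have h2 := h1.trans Finset.card_image_le
      rw [Nat.card_Ioo] at h2
      omega
    obtain ⟨z, hz, j, hj, hyz⟩ := hcoset
    have : (a i : ZMod m) + y = -z + (a i + a j) := by rw [← hyz]; ring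
    rw [this]
    exact hstable _ (hneg z hz) _ (hsmall j hj)
  intro x hx y hy
  obtain ⟨i, hi, rfl⟩ := mem_residues.1 hx
  exact key i hi y hy

/-- If `p ∣ m` divides the first `K` elements of the Apéry sequence, then `K * p ≤ m`. -/
theorem mul_le_of_dvd (h : IsAperySeq S m a) {K p : ℕ} (hK : K ≤ m) (hpm : p ∣ m)
    (hp : ∀ i < K, p ∣ a i) : K * p ≤ m := by
  have h1 := h.one_lt
  obtain ⟨q, rfl⟩ := hpm
  have hp0 : 0 < p := by
    rcases Nat.eq_zero_or_pos p with rfl | h0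
    · simp at h1
    · exact h0
  have : residues (p * q) a K ⊆ (Finset.range q).image fun t => ((p * t : ℕ) : ZMod (p * q)) := by
    intro x hx
    obtain ⟨i, hi, rfl⟩ := mem_residues.1 hx
    obtain ⟨t, ht⟩ := hp i hi
    refine Finset.mem_image.2 ⟨t % q, Finset.mem_range.2 (Nat.mod_lt _ ?_), ?_⟩
    · rcases Nat.eq_zero_or_pos q with rfl | h0
      · simp at h1
      · exact h0
    · rw [ht, ZMod.natCast_eq_natCast_iff]
      exact (Nat.mod_modEq t q).mul_left' p
  have h2 := (Finset.card_le_card this).trans Finset.card_image_le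
  rw [h.card_residues hK, Finset.card_range] at h2
  calc K * p ≤ q * p := Nat.mul_le_mul_right _ h2
    _ = p * q := mul_comm _ _

/-- The symmetry of the Apéry sequence. -/
theorem symm (h : IsAperySeq S m a) {i : ℕ} (hi : i < m) : a i + a (m - 1 - i) = a (m - 1) := by
  have h1 := h.one_lt
  -- `σ i` is the index of the class complementary to that of `a i`; it permutes the indices. Only
  -- afterwards does `σ i = m - 1 - i` become plausible, and it is not needed.
  choose σ hσ hσ' using fun i => h.exists_index (a (m - 1) - a i : ZMod m)
  have hle : ∀ i ∈ Finset.range m, a i + a (m - 1 - i) ≤ a (m - 1) := by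
    intro i hi
    rw [Finset.mem_range] at hi
    have := h.superadd i (m - 1 - i) (by omega)
    rwa [show i + (m - 1 - i) = m - 1 by omega] at this
  have hge : ∀ i ∈ Finset.range m, a (m - 1) ≤ a i + a (σ i) := by
    intro i hi
    rw [Finset.mem_range] at hi
    refine h.le_of_mem (S.add_mem (h.mem hi) (h.mem (hσ i))) (by omega) ?_
    rw [Nat.cast_add, ← hσ']
    ring
  have hσsum : ∑ i ∈ Finset.range m, a (σ i) = ∑ i ∈ Finset.range m, a i := by
    have hinj : Set.InjOn σ (Finset.range m : Set ℕ) := by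
      intro i hi j hj hij
      simp only [Finset.coe_range, Set.mem_Iio] at hi hj
      refine h.inj i hi j hj ?_
      have e1 := hσ' i
      rw [hij, ← hσ' j] at e1
      exact sub_right_injective e1
    have himg : (Finset.range m).image σ = Finset.range m := by
      refine Finset.eq_of_subset_of_card_le ?_ ?_
      · intro x hx
        obtain ⟨i, -, rfl⟩ := Finset.mem_image.1 hx
        exact Finset.mem_range.2 (hσ i)
      · rw [Finset.card_image_of_injOn hinj]
    conv_rhs => rw [← himg]
    rw [Finset.sum_image hinj]
  have hrefl := Finset.sum_range_reflect a m
  -- Summing `hle` and `hge` squeezes `m * a (m - 1)` between two sums that both equal `2 * ∑ a i`,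
  -- so each inequality in `hle` is an equality.
  have hsum : ∑ i ∈ Finset.range m, (a i + a (m - 1 - i)) = ∑ i ∈ Finset.range m, a (m - 1) := by
    refine le_antisymm (Finset.sum_le_sum hle) ?_
    refine (Finset.sum_le_sum hge).trans (le_of_eq ?_)
    rw [Finset.sum_add_distrib, Finset.sum_add_distrib, hσsum, hrefl]
  exact (Finset.sum_eq_sum_iff_of_le hle).1 hsum i (Finset.mem_range.2 hi)

/-- The conductor of `S`. -/
def conductor (m : ℕ) (a : ℕ → ℕ) : ℕ := a (m - 1) - m + 1

theorem conductor_add (h : IsAperySeq S m a) : conductor m a + m = a (m - 1) + 1 := by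
  have h1 := h.one_lt
  have h2 := h.add_lt (i := 0) (j := m - 1) (by omega) (by omega)
  unfold conductor
  omega

/-- A non-element `x` in the class of `a i` is at most `a i - m ≤ a (m - 1) - m`, which is the
conductor minus one. -/
theorem mem_of_conductor_le (h : IsAperySeq S m a) {x : ℕ} (hx : conductor m a ≤ x) : x ∈ S := by
  have h1 := h.one_lt
  have hc := h.conductor_add
  obtain ⟨i, hi, hxi⟩ := h.exists_index (x : ZMod m)
  by_cases hle : a i ≤ x
  · exact h.mem_of_le hi hxi hle
  exfalso
  have h2 := h.mono (i := i) (j := m - 1) (by omega) (by omega)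
  have hd : m ∣ a i - x := by
    rw [← Nat.modEq_iff_dvd' (by omega)]
    exact (ZMod.natCast_eq_natCast_iff _ _ _).1 hxi
  have := Nat.le_of_dvd (by omega) hd
  omega

/-- `S` is symmetric. -/
theorem mem_iff_notMem (h : IsAperySeq S m a) {x y : ℕ} (hxy : x + y + 1 = conductor m a) :
    x ∈ S ↔ y ∉ S := by
  have h1 := h.one_lt
  have hc := h.conductor_add
  constructor
  · intro hx hy
    -- Here `x + y = a (m - 1) - m`, which lies below the Apéry element of its class.
    have := h.le_of_mem (S.add_mem hx hy) (i := m - 1) (by omega) (by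
      have : x + y + m = a (m - 1) := by omega
      rw [← this]; simp)
    omega
  · intro hy
    obtain ⟨i, hi, hyi⟩ := h.exists_index (y : ZMod m)
    have hle : ¬ a i ≤ y := fun hle => hy (h.mem_of_le hi hyi hle)
    have hd : m ∣ a i - y := by
      rw [← Nat.modEq_iff_dvd' (by omega)]
      exact (ZMod.natCast_eq_natCast_iff _ _ _).1 hyi
    obtain ⟨k, hk⟩ := hd
    have hs := h.symm hi
    have hk0 : k ≠ 0 := by rintro rfl; omega
    obtain ⟨k, rfl⟩ := Nat.exists_eq_succ_of_ne_zero hk0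
    -- From `y = a i - m * (k + 1)` and the symmetry, `x = a (m - 1 - i) + m * k`.
    refine (h.mem_iff _).2 ⟨m - 1 - i, by omega, k, ?_⟩
    rw [Nat.mul_succ] at hk
    omega

/-- The reflection `x ↦ c - 1 - x` exchanges elements and gaps below the conductor `c`, and there
are no gaps from `c` on. -/
theorem two_mul_delta (h : IsAperySeq S m a) : 2 * delta S = conductor m a := by
  classical
  set c := conductor m a with hc
  have hgap : ((S : Set ℕ)ᶜ) = ((Finset.range c).filter fun x => x ∉ S : Finset ℕ) := by
    ext x
    simp only [Set.mem_compl_iff, SetLike.mem_coe, Finset.coe_filter, Finset.mem_range,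
      Set.mem_ofPred_eq]
    refine ⟨fun hx => ⟨?_, hx⟩, fun hx => hx.2⟩
    by_contra hle
    exact hx (h.mem_of_conductor_le (not_lt.1 hle))
  have h1 : delta S = ((Finset.range c).filter fun x => x ∉ S).card := by
    rw [delta, hgap, Set.ncard_coe_finset]
  have h2 : ((Finset.range c).filter fun x => x ∈ S).card =
      ((Finset.range c).filter fun x => x ∉ S).card := by
    refine Finset.card_bij' (fun x _ => c - 1 - x) (fun x _ => c - 1 - x) ?_ ?_ ?_ ?_
    · intro x hx
      rw [Finset.mem_filter, Finset.mem_range] at hx ⊢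
      exact ⟨by omega, (h.mem_iff_notMem (by omega)).1 hx.2⟩
    · intro x hx
      rw [Finset.mem_filter, Finset.mem_range] at hx ⊢
      exact ⟨by omega, (h.mem_iff_notMem (by omega)).2 hx.2⟩
    · intro x hx
      rw [Finset.mem_filter, Finset.mem_range] at hx
      omega
    · intro x hx
      rw [Finset.mem_filter, Finset.mem_range] at hx
      omega
  have h3 := Finset.card_filter_add_card_filter_not (s := Finset.range c) (fun x => x ∈ S)
  rw [Finset.card_range] at h3
  omega

theorem multiplicity_eq (h : IsAperySeq S m a) : multiplicity S = m := by
  have h1 := h.one_lt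
  refine IsLeast.csInf_eq ⟨⟨h.mult_mem, by omega⟩, ?_⟩
  rintro s ⟨hs, hs0⟩
  obtain ⟨i, hi, k, rfl⟩ := (h.mem_iff _).1 hs
  rcases Nat.eq_zero_or_pos i with rfl | hi0
  · rw [h.zero] at hs0 ⊢
    have : 0 < k := Nat.pos_of_ne_zero (by rintro rfl; simp at hs0)
    nlinarith
  · have := h.add_lt hi0 hi
    omega

theorem mult_le_of_mem (h : IsAperySeq S m a) {s : ℕ} (hs : s ∈ S) (hs0 : s ≠ 0) : m ≤ s := by
  rw [← h.multiplicity_eq]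
  exact Nat.sInf_le ⟨hs, hs0⟩

end IsAperySeq

/-! ## The last generator -/

/-- `b = a D` is the last element of the Apéry sequence that is not decomposable. -/
structure IsLastIndec (m : ℕ) (a : ℕ → ℕ) (D : ℕ) : Prop where
  pos : 0 < D
  lt : D < m
  indec : ¬ IsDecomposable a D
  dec : ∀ i < m, D < i → IsDecomposable a i

namespace IsAperySeq

variable {S : AddSubmonoid ℕ} {m : ℕ} {a : ℕ → ℕ}

theorem exists_isLastIndec (h : IsAperySeq S m a) : ∃ D, IsLastIndec m a D := by
  classical
  have h1 := h.one_lt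
  set T := (Finset.Ioo 0 m).filter fun D => ¬ IsDecomposable a D with hT
  have hne : T.Nonempty := by
    refine ⟨1, Finset.mem_filter.2 ⟨Finset.mem_Ioo.2 ⟨by omega, h1⟩, ?_⟩⟩
    rintro ⟨i, j, hi, hj, hij, -⟩
    omega
  obtain ⟨hD, hdec⟩ := Finset.mem_filter.1 (T.max'_mem hne)
  rw [Finset.mem_Ioo] at hD
  refine ⟨T.max' hne, hD.1, hD.2, hdec, fun i hi hDi => ?_⟩
  by_contra hc
  have := T.le_max' i (Finset.mem_filter.2 ⟨Finset.mem_Ioo.2 ⟨by omega, hi⟩, hc⟩)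
  omega

variable {D : ℕ}

/-- The first `D` classes form a subgroup of `ℤ/m` of order `D`. Lagrange's theorem gives `D ∣ m`,
and its elements are killed by `D`, so `m ∣ D * a i`. -/
theorem dvd_and_dvd (h : IsAperySeq S m a) (hD : IsLastIndec m a D) :
    D ∣ m ∧ ∀ i < D, m / D ∣ a i := by
  have h1 := h.one_lt
  have hDm := hD.lt
  have hadd := h.residues_add_mem D hD.lt hD.indec
  have hn : ∀ z ∈ residues m a D, ∀ n : ℕ, n • z ∈ residues m a D := by
    intro z hz n
    induction n with
    | zero => simpa using h.zero_mem_residues hD.pos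
    | succ n ihn => rw [succ_nsmul]; exact hadd _ ihn _ hz
  let H : AddSubgroup (ZMod m) :=
    { carrier := residues m a D
      zero_mem' := h.zero_mem_residues hD.pos
      add_mem' := fun {x y} hx hy => hadd x hx y hy
      neg_mem' := fun {z} hz => by
        have : -z = (m - 1) • z := by
          rw [nsmul_eq_mul, Nat.cast_sub (by omega)]
          simp
        rw [this]
        exact hn z hz _ }
  have hcard : Nat.card H = D := by
    have : Nat.card H = ((residues m a D : Finset (ZMod m)) : Set (ZMod m)).ncard := rfl
    rw [this, Set.ncard_coe_finset, h.card_residues hDm.le]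
  have hdvd : D ∣ m := by
    have := H.card_addSubgroup_dvd_card
    rwa [hcard, Nat.card_zmod] at this
  refine ⟨hdvd, fun i hi => ?_⟩
  have hmem : (a i : ZMod m) ∈ H := mem_residues.2 ⟨i, hi, rfl⟩
  have h0 : D • (⟨a i, hmem⟩ : H) = 0 := by
    rw [← hcard]
    exact card_nsmul_eq_zero'
  have h2 : ((D * a i : ℕ) : ZMod m) = 0 := by
    have := congrArg Subtype.val h0
    simpa using this
  rw [ZMod.natCast_eq_zero_iff] at h2
  rw [Nat.div_dvd_iff_dvd_mul hdvd hD.pos]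
  exact h2

/-- A common divisor of `m` and of the Apéry sequence up to the last indecomposable element is
trivial. -/
theorem eq_one_of_dvd (h : IsAperySeq S m a) (hD : IsLastIndec m a D) {p : ℕ} (hpm : p ∣ m)
    (hp : ∀ i ≤ D, p ∣ a i) : p = 1 := by
  have h1 := h.one_lt
  have hall : ∀ i < m, p ∣ a i := by
    intro i
    induction i using Nat.strong_induction_on with
    | _ i ih =>
    intro hi
    by_cases hiD : i ≤ D
    · exact hp i hiD
    · obtain ⟨q, r, hq, hr, hqr, he⟩ := hD.dec i hi (by omega)
      rw [he]
      exact dvd_add (ih q (by omega) (by omega)) (ih r (by omega) (by omega))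
  have h2 := h.mul_le_of_dvd le_rfl hpm hall
  have h3 : p ≠ 0 := by rintro rfl; have := Nat.eq_zero_of_zero_dvd hpm; omega
  have h4 : ¬ 1 < p := fun hlt => by nlinarith
  omega

/-- Indecomposability only concerns complementary indices, so an arbitrary sum has to be excluded.
As `a D - m ∉ S`, both summands would be earlier Apéry elements; but sums of their classes stay
among the first `D` classes, which do not contain that of `a D`. -/
theorem lastIndec_mem_minimalGenerators (h : IsAperySeq S m a) (hD : IsLastIndec m a D) :
    a D ∈ minimalGenerators S := by
  have h1 := h.one_lt
  have hpos := h.add_lt hD.pos hD.lt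
  refine ⟨h.mem hD.lt, by omega, ?_⟩
  rintro ⟨s, hs, t, ht, hs0, ht0, hst⟩
  have hsub : a D - m ∉ S := fun hmem => by
    have := h.le_of_mem hmem hD.lt (by rw [Nat.cast_sub (by omega)]; simp)
    omega
  obtain ⟨i, hi, k, rfl⟩ := (h.mem_iff _).1 hs
  obtain ⟨j, hj, l, rfl⟩ := (h.mem_iff _).1 ht
  have hk : k = 0 := by
    by_contra hk
    obtain ⟨k, rfl⟩ := Nat.exists_eq_succ_of_ne_zero hk
    rw [Nat.mul_succ] at hst
    refine hsub ?_
    rw [show a D - m = (a i + m * k) + (a j + m * l) by omega]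
    exact S.add_mem ((h.mem_iff _).2 ⟨i, hi, k, rfl⟩) ht
  have hl : l = 0 := by
    by_contra hl
    obtain ⟨l, rfl⟩ := Nat.exists_eq_succ_of_ne_zero hl
    rw [Nat.mul_succ] at hst
    refine hsub ?_
    rw [show a D - m = (a i + m * k) + (a j + m * l) by omega]
    exact S.add_mem hs ((h.mem_iff _).2 ⟨j, hj, l, rfl⟩)
  subst hk hl
  simp only [mul_zero, add_zero] at *
  have hiD : i < D := (h.lt_iff hi hD.lt).1 (by omega)
  have hjD : j < D := (h.lt_iff hj hD.lt).1 (by omega)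
  obtain ⟨k, hk, hk'⟩ := mem_residues.1 (h.residues_add_mem D hD.lt hD.indec _
    (mem_residues.2 ⟨i, hiD, rfl⟩) _ (mem_residues.2 ⟨j, hjD, rfl⟩))
  have := h.inj k (by have := hD.lt; omega) D hD.lt (by rw [hk', ← hst, Nat.cast_add])
  omega

/-- Apéry elements after `a D` are decomposable, and from any `a i + m * k` with `k > 0` a summand
`m` splits off. -/
theorem mem_minimalGenerators_cases (h : IsAperySeq S m a) (hD : IsLastIndec m a D) {s : ℕ}
    (hs : s ∈ minimalGenerators S) : s = m ∨ ∃ i ≤ D, s = a i := by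
  have h1 := h.one_lt
  obtain ⟨hsS, hs0, hno⟩ := hs
  obtain ⟨i, hi, k, rfl⟩ := (h.mem_iff _).1 hsS
  rcases Nat.eq_zero_or_pos k with rfl | hk
  · right
    refine ⟨i, ?_, by simp⟩
    by_contra hc
    obtain ⟨p, q, hp, hq, hpq, he⟩ := hD.dec i hi (not_le.1 hc)
    have h2 := h.add_lt hp (by omega)
    have h3 := h.add_lt hq (by omega)
    exact hno ⟨a p, h.mem (by omega), a q, h.mem (by omega), by omega, by omega, by simp [he]⟩
  · left
    obtain ⟨k, rfl⟩ := Nat.exists_eq_succ_of_ne_zero hk.ne'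
    by_contra hne
    refine hno ⟨a i + m * k, (h.mem_iff _).2 ⟨i, hi, k, rfl⟩, m, h.mult_mem, ?_, by omega, by
      rw [Nat.mul_succ]; omega⟩
    intro h0
    rw [Nat.mul_succ] at hne
    omega

theorem le_lastIndec (h : IsAperySeq S m a) (hD : IsLastIndec m a D) {s : ℕ}
    (hs : s ∈ minimalGenerators S) : s ≤ a D := by
  rcases h.mem_minimalGenerators_cases hD hs with rfl | ⟨i, hi, rfl⟩
  · have := h.add_lt hD.pos hD.lt
    omega
  · exact h.mono hi hD.lt

theorem mult_mem_minimalGenerators (h : IsAperySeq S m a) : m ∈ minimalGenerators S := by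
  have h1 := h.one_lt
  refine ⟨h.mult_mem, by omega, ?_⟩
  rintro ⟨s, hs, t, ht, hs0, ht0, hst⟩
  have := h.mult_le_of_mem hs hs0
  omega

end IsAperySeq

/-! ### Enumeration of the minimal generators -/

section Beta

open Classical in
theorem lastIndex_eq_count {S : AddSubmonoid ℕ} {b : ℕ} (hb : b ∈ minimalGenerators S)
    (hmax : ∀ s ∈ minimalGenerators S, s ≤ b) :
    lastIndex S = Nat.count (· ∈ minimalGenerators S) b := by
  have : minimalGenerators S =
      (insert b ((Finset.range b).filter (· ∈ minimalGenerators S)) : Finset ℕ) := by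
    ext x
    simp only [Finset.coe_insert, Finset.coe_filter, Finset.mem_range, Set.mem_insert_iff,
      Set.mem_ofPred_eq]
    constructor
    · intro hx
      have := hmax x hx
      rcases this.eq_or_lt with rfl | hlt
      · exact Or.inl rfl
      · exact Or.inr ⟨hlt, hx⟩
    · rintro (rfl | hx)
      · exact hb
      · exact hx.2
  rw [lastIndex, Nat.count_eq_card_filter_range]
  conv_lhs => rw [this]
  rw [Set.ncard_coe_finset, Finset.card_insert_of_notMem (by simp)]
  rfl

/-- The last of the `β_i` is the largest minimal generator. -/
theorem beta_lastIndex {S : AddSubmonoid ℕ} {b : ℕ} (hb : b ∈ minimalGenerators S)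
    (hmax : ∀ s ∈ minimalGenerators S, s ≤ b) : beta S (lastIndex S) = b := by
  classical
  rw [lastIndex_eq_count hb hmax, beta, Nat.nth_count hb]

/-- Replaces the enumerated gcd by an index-free divisibility criterion. The generator `m < b`
ensures `lastIndex S > 0`, so that the truncated subtraction is a true one. -/
theorem dvd_gcdBeta_iff {S : AddSubmonoid ℕ} {b m : ℕ} (hb : b ∈ minimalGenerators S)
    (hmax : ∀ s ∈ minimalGenerators S, s ≤ b) (hm : m ∈ minimalGenerators S) (hmb : m < b)
    (d : ℕ) : d ∣ gcdBeta S (lastIndex S - 1) ↔ ∀ s ∈ minimalGenerators S, s < b → d ∣ s := by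
  classical
  have hl := lastIndex_eq_count hb hmax
  have hpos : 0 < lastIndex S := by
    rw [hl]
    exact (Nat.zero_le _).trans_lt (Nat.count_strict_mono hm hmb)
  have hfin : (Set.ofPred (· ∈ minimalGenerators S)).Finite :=
    (Set.finite_Iic b).subset fun s hs => hmax s hs
  rw [gcdBeta, Finset.dvd_gcd_iff, show lastIndex S - 1 + 1 = lastIndex S by omega]
  constructor
  · intro hd s hs hsb
    have := hd (Nat.count (· ∈ minimalGenerators S) s)
      (Finset.mem_range.2 (by rw [hl]; exact Nat.count_strict_mono hs hsb))
    rwa [beta, Nat.nth_count hs] at this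
  · intro hd i hi
    rw [Finset.mem_range, hl] at hi
    have hlt : Nat.nth (· ∈ minimalGenerators S) i < b := Nat.nth_lt_of_lt_count hi
    have hb' := Nat.nth_count (p := (· ∈ minimalGenerators S)) hb
    refine hd _ ?_ hlt
    -- `Nat.nth` is `0` past the end of a finite set; this does not occur for `i`, since even the
    -- index of `b` yields `b > 0`.
    refine Nat.nth_mem i fun hf => ?_
    have : Nat.count (· ∈ minimalGenerators S) b < hf.toFinset.card := by
      by_contra hc
      have h0 := Nat.nth_of_card_le hf (not_lt.1 hc)
      rw [hb'] at h0
      omega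
    omega

end Beta

/-! ### The invariants in terms of the Apéry sequence -/

namespace IsAperySeq

variable {S : AddSubmonoid ℕ} {m : ℕ} {a : ℕ → ℕ} {D : ℕ}

theorem beta_lastIndex_eq (h : IsAperySeq S m a) (hD : IsLastIndec m a D) :
    beta S (lastIndex S) = a D :=
  beta_lastIndex (h.lastIndec_mem_minimalGenerators hD) fun _ hs => h.le_lastIndec hD hs

/-- `m / D` divides every generator below `a D`, hence the gcd `p`. Conversely `p` divides `m` and
`a i` for `i < D`, so `D * p ≤ m` by `mul_le_of_dvd`, and the two coincide. -/
theorem gcdBeta_eq (h : IsAperySeq S m a) (hD : IsLastIndec m a D) :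
    gcdBeta S (lastIndex S - 1) = m / D := by
  have h1 := h.one_lt
  have hmD := h.add_lt hD.pos hD.lt
  obtain ⟨hDm, hdiv⟩ := h.dvd_and_dvd hD
  have hiff := dvd_gcdBeta_iff (h.lastIndec_mem_minimalGenerators hD)
    (fun _ hs => h.le_lastIndec hD hs) h.mult_mem_minimalGenerators (by omega)
  refine Nat.dvd_antisymm ?_ ((hiff _).2 ?_)
  · set p := gcdBeta S (lastIndex S - 1) with hp
    have hgen := (hiff p).1 dvd_rfl
    have hpm : p ∣ m := hgen m h.mult_mem_minimalGenerators (by omega)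
    have hsmall : ∀ s ∈ S, s < a D → p ∣ s := by
      intro s
      induction s using Nat.strong_induction_on with
      | _ s ih =>
      intro hs hlt
      rcases Nat.eq_zero_or_pos s with rfl | hs0
      · exact dvd_zero _
      by_cases hmin : s ∈ minimalGenerators S
      · exact hgen s hmin hlt
      · have : ∃ x ∈ S, ∃ y ∈ S, x ≠ 0 ∧ y ≠ 0 ∧ x + y = s := by
          by_contra hc
          exact hmin ⟨hs, hs0.ne', hc⟩
        obtain ⟨x, hx, y, hy, hx0, hy0, rfl⟩ := this
        exact dvd_add (ih x (by omega) hx (by omega)) (ih y (by omega) hy (by omega))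
    have hpa : ∀ i < D, p ∣ a i := fun i hi => hsmall _ (h.mem (by have := hD.lt; omega))
      ((h.lt_iff (by have := hD.lt; omega) hD.lt).2 hi)
    have hle := h.mul_le_of_dvd hD.lt.le hpm hpa
    have hed : m / D ∣ p := (hiff _).2 (by
      intro s hs hsb
      rcases h.mem_minimalGenerators_cases hD hs with rfl | ⟨i, hi, rfl⟩
      · exact Nat.div_dvd_of_dvd hDm
      · exact hdiv i ((h.lt_iff (by have := hD.lt; omega) hD.lt).1 hsb))
    have hp0 : 0 < p := Nat.pos_of_dvd_of_pos hpm (by omega)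
    have h3 := Nat.le_of_dvd hp0 hed
    have h4 : p ≤ m / D := (Nat.le_div_iff_mul_le hD.pos).2 (by rwa [mul_comm])
    rw [le_antisymm h4 h3]
  · intro s hs hsb
    rcases h.mem_minimalGenerators_cases hD hs with rfl | ⟨i, hi, rfl⟩
    · exact Nat.div_dvd_of_dvd hDm
    · exact hdiv i ((h.lt_iff (by have := hD.lt; omega) hD.lt).1 hsb)

/-- Superadditivity along the multiples of the last generator. -/
theorem mul_add_le (h : IsAperySeq S m a) (q r : ℕ) (hqr : q * D + r < m) :
    q * a D + a r ≤ a (q * D + r) := by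
  induction q with
  | zero => simp
  | succ q ih =>
    rw [Nat.succ_mul] at hqr
    have h1 := ih (by omega)
    have h2 := h.superadd D (q * D + r) (by omega)
    rw [Nat.succ_mul, Nat.succ_mul, show q * D + D + r = D + (q * D + r) by ring]
    omega

/-- If the gcd of the generators before the last one is not `2`, then the last generator is
small, or the multiplicity is `3`. -/
theorem two_mul_lastIndec_lt (h : IsAperySeq S m a) (hD : IsLastIndec m a D) (he : m / D ≠ 2) :
    2 * a D < conductor m a ∨ m = 3 := by
  have h1 := h.one_lt
  have hDm' := hD.lt
  have hD0 := hD.pos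
  have hmD := h.add_lt hD.pos hD.lt
  have hc := h.conductor_add
  obtain ⟨e, he'⟩ := (h.dvd_and_dvd hD).1
  have he2 : e ≠ 2 := by
    rintro rfl
    rw [he', Nat.mul_div_cancel_left _ hD.pos] at he
    exact he rfl
  have he0 : e ≠ 0 := by rintro rfl; omega
  have he1 : e ≠ 1 := by rintro rfl; omega
  obtain ⟨f, rfl⟩ : ∃ f, e = f + 3 := ⟨e - 3, by omega⟩
  have hidx : (f + 2) * D + (D - 1) = m - 1 := by
    have : m = (f + 2) * D + D := by rw [he']; ring
    omega
  have hsup := h.mul_add_le (D := D) (f + 2) (D - 1) (by omega)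
  rw [hidx] at hsup
  -- The bound shows that the conductor exceeds `2 * a D` by at least `f * a D + a (D - 1) - m + 1`.
  -- This is positive unless `f = 0` and `D = 1`, that is `m = 3`.
  rcases Nat.eq_zero_or_pos f with rfl | hf
  · by_cases hD1 : D = 1
    · right; subst hD1; omega
    · left
      have := h.add_lt (i := 0) (j := D - 1) (by omega) (by omega)
      omega
  · left
    have : 3 * a D ≤ (f + 2) * a D := Nat.mul_le_mul_right _ (by omega)
    omega

/-- The shape of `S` if the gcd of the generators before the last one is `2`. -/
theorem even_odd_structure (h : IsAperySeq S m a) (hD : IsLastIndec m a D) (he : m / D = 2) :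
    Odd (a D) ∧ (∀ s ∈ S, Odd s → a D ≤ s) ∧ (∀ x, Even x → a D ≤ x + 1 → x ∈ S) ∧
      conductor m a < 2 * a D ∧ m ≠ 3 := by
  have h1 := h.one_lt
  have hDm' := hD.lt
  have hD0 := hD.pos
  obtain ⟨hDm, hdiv⟩ := h.dvd_and_dvd hD
  have hm : m = D * 2 := by rw [← he, Nat.mul_div_cancel' hDm]
  rw [he] at hdiv
  have h2m : 2 ∣ m := ⟨D, by omega⟩
  have hodd : Odd (a D) := by
    rw [← Nat.not_even_iff_odd, even_iff_two_dvd]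
    intro hev
    have := h.eq_one_of_dvd hD h2m fun i hi => by
      rcases hi.eq_or_lt with rfl | hlt
      · exact hev
      · exact hdiv i hlt
    omega
  have hoddS : ∀ s ∈ S, Odd s → a D ≤ s := by
    intro s hs hso
    obtain ⟨i, hi, k, rfl⟩ := (h.mem_iff _).1 hs
    have : D ≤ i := by
      by_contra hc
      rw [← Nat.not_even_iff_odd, even_iff_two_dvd] at hso
      exact hso (dvd_add (hdiv i (by omega)) (h2m.mul_right _))
    have := h.mono this hi
    omega
  -- The first `D` classes are distinct and even, and there are only `D` even classes modulo `m = 2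
  -- * D`.
  have hres : residues m a D = (Finset.range D).image fun t => ((2 * t : ℕ) : ZMod m) := by
    refine Finset.eq_of_subset_of_card_le ?_ ?_
    · intro x hx
      obtain ⟨i, hi, rfl⟩ := mem_residues.1 hx
      obtain ⟨t, ht⟩ := hdiv i hi
      refine Finset.mem_image.2 ⟨t % D, Finset.mem_range.2 (Nat.mod_lt _ hD0), ?_⟩
      rw [ht, hm, mul_comm D 2, ZMod.natCast_eq_natCast_iff]
      exact (Nat.mod_modEq t D).mul_left' 2
    · rw [h.card_residues hDm'.le]
      exact Finset.card_image_le.trans (by simp)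
  have heven : ∀ x : ℕ, Even x → ∃ i < D, (x : ZMod m) = a i := by
    intro x hx
    obtain ⟨t, ht⟩ := even_iff_two_dvd.1 hx
    have : (x : ZMod m) ∈ residues m a D := by
      rw [hres]
      refine Finset.mem_image.2 ⟨t % D, Finset.mem_range.2 (Nat.mod_lt _ hD0), ?_⟩
      rw [ht, hm, mul_comm D 2, ZMod.natCast_eq_natCast_iff]
      exact (Nat.mod_modEq t D).mul_left' 2
    obtain ⟨i, hi, hi'⟩ := mem_residues.1 this
    exact ⟨i, hi, hi'.symm⟩
  refine ⟨hodd, hoddS, ?_, ?_, by omega⟩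
  · intro x hx hle
    obtain ⟨i, hi, hxi⟩ := heven x hx
    have := h.add_lt hi hDm'
    exact h.mem_of_le (by omega) hxi (by omega)
  · have hc := h.conductor_add
    -- The even classes are used up by indices below `D ≤ m - 1`.
    have hlast : Odd (a (m - 1)) := by
      rw [← Nat.not_even_iff_odd]
      intro hev
      obtain ⟨i, hi, hxi⟩ := heven _ hev
      have := h.inj (m - 1) (by omega) i (by omega) hxi
      omega
    have hge := h.mono (i := D) (j := m - 1) (by omega) (by omega)
    obtain ⟨i, hi, hxi⟩ := heven (a (m - 1) - a D) (Nat.Odd.sub_odd hlast hodd)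
    -- The even number `a (m - 1) - a D` has the class of some `a i` with `a i + m < a D`; this
    -- bounds the conductor by `2 * a D`.
    have h3 : a (m - 1) ≤ a D + a i := by
      refine h.le_of_mem (S.add_mem (h.mem hDm') (h.mem (by omega))) (by omega) ?_
      rw [Nat.cast_add, ← hxi, Nat.cast_sub hge]
      ring
    have := h.add_lt hi hDm'
    omega

/-- There is an odd element of `S` that is at most the last generator. -/
theorem exists_odd_le (h : IsAperySeq S m a) (hD : IsLastIndec m a D) :
    ∃ s ∈ S, Odd s ∧ s ≤ a D := by
  by_contra hc
  push Not at hc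
  have hmD := h.add_lt hD.pos hD.lt
  have h2 : ∀ s ∈ S, s ≤ a D → 2 ∣ s := by
    intro s hs hle
    rw [← even_iff_two_dvd, ← Nat.not_odd_iff_even]
    intro ho
    have := hc s hs ho
    omega
  have := h.eq_one_of_dvd hD (h2 m h.mult_mem (by omega)) fun i hi =>
    h2 _ (h.mem (by have := hD.lt; omega)) (h.mono hi hD.lt)
  omega

end IsAperySeq

/-! ## Sublevel sets -/

section Sublevel

variable {w : ℕ → ℤ}

theorem natCast_mem_sublevel {n : ℤ} {l : ℕ} : (l : ℝ) ∈ sublevel w n ↔ w l ≤ n := by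
  simp [sublevel, extWeight]

theorem mem_sublevel_iff {n : ℤ} {x : ℝ} :
    x ∈ sublevel w n ↔ 0 ≤ x ∧ w ⌊x⌋₊ ≤ n ∧ w ⌈x⌉₊ ≤ n := by
  simp [sublevel, extWeight]

theorem Icc_subset_sublevel {n : ℤ} {l : ℕ} (h1 : w l ≤ n) (h2 : w (l + 1) ≤ n) :
    Set.Icc (l : ℝ) ((l + 1 : ℕ) : ℝ) ⊆ sublevel w n := by
  intro x hx
  have h0 : 0 ≤ x := (Nat.cast_nonneg l).trans hx.1
  have hf : l ≤ ⌊x⌋₊ := Nat.le_floor hx.1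
  have hc : ⌈x⌉₊ ≤ l + 1 := Nat.ceil_le.2 hx.2
  have hfc := Nat.floor_le_ceil x
  rw [mem_sublevel_iff]
  refine ⟨h0, ?_, ?_⟩
  · rcases (show ⌊x⌋₊ = l ∨ ⌊x⌋₊ = l + 1 by omega) with h | h <;> rw [h] <;> assumption
  · rcases (show ⌈x⌉₊ = l ∨ ⌈x⌉₊ = l + 1 by omega) with h | h <;> rw [h] <;> assumption

theorem Icc_floor_subset_sublevel {n : ℤ} {x : ℝ} (hx : x ∈ sublevel w n) :
    Set.Icc (⌊x⌋₊ : ℝ) x ⊆ sublevel w n := by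
  obtain ⟨h0, h1, h2⟩ := mem_sublevel_iff.1 hx
  intro z hz
  have hz0 : 0 ≤ z := (Nat.cast_nonneg _).trans hz.1
  have e1 : ⌊x⌋₊ ≤ ⌊z⌋₊ := Nat.le_floor hz.1
  have e2 : ⌊z⌋₊ ≤ ⌊x⌋₊ := Nat.floor_le_floor hz.2
  have e3 : ⌈z⌉₊ ≤ ⌈x⌉₊ := Nat.ceil_le_ceil hz.2
  have e4 := Nat.floor_le_ceil z
  have e5 : ⌈x⌉₊ ≤ ⌊x⌋₊ + 1 := Nat.ceil_le_floor_add_one x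
  rw [mem_sublevel_iff, le_antisymm e2 e1]
  refine ⟨hz0, h1, ?_⟩
  rcases (show ⌈z⌉₊ = ⌊x⌋₊ ∨ ⌈z⌉₊ = ⌈x⌉₊ by omega) with h | h <;> rw [h] <;> assumption

theorem ordConnected_sublevel {n : ℤ}
    (h : ∀ p r q, p ≤ r → r ≤ q → w p ≤ n → w q ≤ n → w r ≤ n) :
    (sublevel w n).OrdConnected := by
  refine ⟨fun x hx y hy z hz => ?_⟩
  rw [mem_sublevel_iff] at hx hy ⊢
  exact ⟨hx.1.trans hz.1,
    h _ _ _ (Nat.floor_le_floor hz.1) (Nat.floor_le_floor hz.2) hx.2.1 hy.2.1,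
    h _ _ _ (Nat.ceil_le_ceil hz.1) (Nat.ceil_le_ceil hz.2) hx.2.2 hy.2.2⟩

/-! ## Ranks -/

/-- If `ℍ⁰_{2n}` has rank one, then it consists of constants. -/
theorem apply_eq_of_finrank {n : ℤ} (h : Module.finrank ℤ (H0 w n) = 1) (f : H0 w n)
    (x y : sublevel w n) : f x = f y := by
  by_contra hne
  have hli : LinearIndependent ℤ ![(1 : H0 w n), f] := by
    rw [LinearIndependent.pair_iff]
    intro s t hst
    have hx := congrArg (fun g : H0 w n => g x) hst
    have hy := congrArg (fun g : H0 w n => g y) hst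
    simp only [LocallyConstant.coe_add, LocallyConstant.coe_smul, Pi.add_apply, Pi.smul_apply,
      LocallyConstant.coe_one, Pi.one_apply, smul_eq_mul, mul_one, LocallyConstant.coe_zero,
      Pi.zero_apply] at hx hy
    have h1 : t * (f x - f y) = 0 := by linear_combination hx - hy
    rcases mul_eq_zero.1 h1 with ht | ht
    · subst ht
      exact ⟨by simpa using hx, rfl⟩
    · exact absurd (sub_eq_zero.1 ht) hne
  have h1 := hli.cardinal_le_rank
  rw [Module.rank_eq_one_iff_finrank_eq_one.2 h] at h1
  simp at h1

/-- As `r` is missing from the sublevel set, its part below `r` is clopen, and the characteristic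
function of that part is not constant. -/
theorem finrank_ne_one_of_separated {n : ℤ} {p r q : ℕ} (hpr : p < r) (hrq : r < q)
    (hp : w p ≤ n) (hq : w q ≤ n) (hr : n < w r) : Module.finrank ℤ (H0 w n) ≠ 1 := by
  intro h
  have hclopen : IsClopen {x : sublevel w n | (x : ℝ) < r} := by
    refine ⟨?_, isOpen_lt continuous_subtype_val continuous_const⟩
    have : {x : sublevel w n | (x : ℝ) < r} = {x : sublevel w n | (x : ℝ) ≤ r} := by
      ext x
      refine ⟨fun hx => show (x : ℝ) ≤ r from le_of_lt hx, fun hx =>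
        show (x : ℝ) < r from lt_of_le_of_ne hx fun hxr => ?_⟩
      have := x.2
      rw [hxr, natCast_mem_sublevel] at this
      omega
    rw [this]
    exact isClosed_le continuous_subtype_val continuous_const
  have := apply_eq_of_finrank h (LocallyConstant.charFn ℤ hclopen)
    ⟨p, natCast_mem_sublevel.2 hp⟩ ⟨q, natCast_mem_sublevel.2 hq⟩
  have hq' : ¬ ((q : ℝ) < r) := by
    rw [Nat.cast_lt]
    omega
  have hp' : ((p : ℝ) < r) := by
    rwa [Nat.cast_lt]
  simp [LocallyConstant.coe_charFn, Set.indicator, hq', hp'] at this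

theorem finrank_eq_one_of_isPreconnected {n : ℤ} (h : IsPreconnected (sublevel w n)) {x : ℝ}
    (hx : x ∈ sublevel w n) : Module.finrank ℤ (H0 w n) = 1 := by
  have : PreconnectedSpace (sublevel w n) := Subtype.preconnectedSpace h
  let e : H0 w n ≃ₗ[ℤ] ℤ :=
    { toFun := fun f => f ⟨x, hx⟩
      invFun := fun c => LocallyConstant.const _ c
      map_add' := fun _ _ => rfl
      map_smul' := fun _ _ => rfl
      left_inv := fun f => by
        ext y
        exact f.apply_eq_of_preconnectedSpace _ _
      right_inv := fun c => rfl }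
  rw [e.finrank_eq, Module.finrank_self]

/-! ## The graded root -/

/-- The component of a point of a sublevel set. -/
def vertexAt (n : ℤ) (x : ℝ) (hx : x ∈ sublevel w n) : RootVertex w :=
  ⟨n, connectedComponentIn (sublevel w n) x, x, hx, rfl⟩

/-- The vertex `u` lies immediately below the vertex `v`. -/
def IsChild (u v : RootVertex w) : Prop := v.chi = u.chi + 1 ∧ u.comp ⊆ v.comp

theorem RootVertex.comp_eq (v : RootVertex w) {x : ℝ} (hx : x ∈ v.comp) :
    v.comp = connectedComponentIn (sublevel w v.chi) x := by
  obtain ⟨y, -, hy⟩ := v.isComp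
  rw [hy] at hx ⊢
  exact connectedComponentIn_eq hx

theorem RootVertex.comp_subset (v : RootVertex w) : v.comp ⊆ sublevel w v.chi := by
  obtain ⟨y, -, hy⟩ := v.isComp
  rw [hy]
  exact connectedComponentIn_subset _ _

theorem RootVertex.exists_mem (v : RootVertex w) : ∃ x, x ∈ v.comp := by
  obtain ⟨y, hy, h⟩ := v.isComp
  exact ⟨y, h ▸ mem_connectedComponentIn hy⟩

theorem RootVertex.isPreconnected (v : RootVertex w) : IsPreconnected v.comp := by
  obtain ⟨y, -, hy⟩ := v.isComp
  rw [hy]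
  exact isPreconnected_connectedComponentIn

theorem mem_vertexAt {n : ℤ} {x : ℝ} (hx : x ∈ sublevel w n) : x ∈ (vertexAt n x hx).comp :=
  mem_connectedComponentIn hx

theorem RootVertex.subset_comp (v : RootVertex w) {s : Set ℝ} (hs : IsPreconnected s)
    (hsub : s ⊆ sublevel w v.chi) {x : ℝ} (hxs : x ∈ s) (hxv : x ∈ v.comp) : s ⊆ v.comp := by
  rw [v.comp_eq hxv]
  exact hs.subset_connectedComponentIn hxs hsub

theorem isChild_vertexAt (v : RootVertex w) {n : ℤ} (hn : v.chi = n + 1) {x : ℝ} (hxv : x ∈ v.comp)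
    (hx : x ∈ sublevel w n) : IsChild (vertexAt n x hx) v := by
  refine ⟨hn, v.subset_comp isPreconnected_connectedComponentIn ?_ (mem_vertexAt hx) hxv⟩
  exact (connectedComponentIn_subset _ _).trans (sublevel_mono w (by omega))

theorem exists_parent (u : RootVertex w) : ∃ v, IsChild u v := by
  obtain ⟨x, hx⟩ := u.exists_mem
  have hx' := sublevel_mono w (show u.chi ≤ u.chi + 1 by omega) (u.comp_subset hx)
  refine ⟨vertexAt (u.chi + 1) x hx', rfl, ?_⟩
  exact RootVertex.subset_comp _ u.isPreconnected
    (u.comp_subset.trans (sublevel_mono w (show u.chi ≤ u.chi + 1 by omega))) hx (mem_vertexAt hx')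

theorem parent_unique {u v v' : RootVertex w} (h : IsChild u v) (h' : IsChild u v') : v = v' := by
  obtain ⟨x, hx⟩ := u.exists_mem
  have hchi : v.chi = v'.chi := by rw [h.1, h'.1]
  ext1
  · exact hchi
  · rw [v.comp_eq (h.2 hx), v'.comp_eq (h'.2 hx), hchi]

/-- Every vertex has exactly one neighbour above it, so being a leaf only depends on what lies
below. -/
theorem isLeaf_iff {v : RootVertex w} : IsLeaf (gradedRoot w) v ↔ ∀ u, ¬ IsChild u v := by
  obtain ⟨p, hp⟩ := exists_parent v
  constructor
  · rintro ⟨q, -, hq'⟩ u hu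
    have h1 := hq' p (Or.inl hp)
    have h2 := hq' u (Or.inr hu)
    have := hp.1
    have := hu.1
    rw [h1, ← h2] at hp
    have := hp.1
    omega
  · intro h
    refine ⟨p, Or.inl hp, ?_⟩
    rintro q (hq | hq)
    · exact parent_unique hq hp
    · exact absurd hq (h q)

theorem isLocalMin_iff {v : RootVertex w} : IsLocalMin w v ↔ ∀ u, ¬ IsChild u v := by
  constructor
  · intro h u hu
    have h1 := h u (Or.inr hu)
    have := hu.1
    omega
  · rintro h u (hu | hu)
    · rw [hu.1]; omega
    · exact absurd hu (h u)

/-- The parent of a vertex is never a leaf, so it survives trimming and is the only neighbour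
exactly when all children are removed. -/
theorem isLeaf_trim_iff {v : {v : RootVertex w // ¬ IsLeaf (gradedRoot w) v}} :
    IsLeaf (trim (gradedRoot w)) v ↔ ∀ u, IsChild u v.1 → IsLeaf (gradedRoot w) u := by
  obtain ⟨p, hp⟩ := exists_parent v.1
  have hpl : ¬ IsLeaf (gradedRoot w) p := fun h => isLeaf_iff.1 h v.1 hp
  constructor
  · rintro ⟨q, -, hq'⟩ u hu
    by_contra hul
    have h1 := hq' ⟨p, hpl⟩ (Or.inl hp)
    have h2 := hq' ⟨u, hul⟩ (Or.inr hu)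
    have h3 : p = u := congrArg Subtype.val (h1.trans h2.symm)
    have := hp.1
    have := hu.1
    rw [← h3] at this
    omega
  · intro h
    refine ⟨⟨p, hpl⟩, Or.inl hp, ?_⟩
    rintro ⟨q, hql⟩ (hq | hq)
    · exact Subtype.ext (parent_unique hq hp)
    · exact absurd (h q hq) hql

theorem le_chi {c : ℤ} (hc : ∀ l, c ≤ w l) (v : RootVertex w) : c ≤ v.chi := by
  obtain ⟨x, hx⟩ := v.exists_mem
  have := (mem_sublevel_iff.1 (v.comp_subset hx)).2.1
  exact (hc _).trans this

/-- Below each vertex of the trimmed root there is a leaf of the trimmed root. -/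
theorem exists_isLeaf_trim {c : ℤ} (hc : ∀ l, c ≤ w l) (v : RootVertex w)
    (hv : ¬ IsLeaf (gradedRoot w) v) :
    ∃ t : {v : RootVertex w // ¬ IsLeaf (gradedRoot w) v},
      IsLeaf (trim (gradedRoot w)) t ∧ t.1.comp ⊆ v.comp := by
  induction hk : (v.chi - c).toNat using Nat.strong_induction_on generalizing v with
  | _ k ih =>
  by_cases h : ∀ u, IsChild u v → IsLeaf (gradedRoot w) u
  · exact ⟨⟨v, hv⟩, isLeaf_trim_iff.2 h, subset_rfl⟩
  · push Not at h
    obtain ⟨u, hu, hul⟩ := h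
    have h1 := le_chi hc u
    have h2 := hu.1
    obtain ⟨t, ht, hsub⟩ := ih _ (by omega) u hul rfl
    exact ⟨t, ht, hsub.trans hu.2⟩

end Sublevel

/-! ## Weight functions of semigroups -/

/-- `w` is the weight function of the semigroup `S`. -/
structure IsWeight (S : AddSubmonoid ℕ) (w : ℕ → ℤ) : Prop where
  zero : w 0 = 0
  succ_of_mem : ∀ l ∈ S, w (l + 1) = w l + 1
  succ_of_notMem : ∀ l, l ∉ S → w (l + 1) = w l - 1

namespace IsWeight

variable {S : AddSubmonoid ℕ} {w : ℕ → ℤ}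

theorem even_iff (h : IsWeight S w) (l : ℕ) : Even (w l) ↔ Even l := by
  induction l with
  | zero => simp [h.zero]
  | succ l ih =>
    by_cases hl : l ∈ S
    · rw [h.succ_of_mem l hl, Int.even_add_one, Nat.even_add_one, ih]
    · rw [h.succ_of_notMem l hl, Int.even_sub_one, Nat.even_add_one, ih]

theorem succ_le (h : IsWeight S w) (l : ℕ) : w (l + 1) ≤ w l + 1 := by
  by_cases hl : l ∈ S
  · rw [h.succ_of_mem l hl]
  · rw [h.succ_of_notMem l hl]; omega

theorem le_succ (h : IsWeight S w) (l : ℕ) : w l ≤ w (l + 1) + 1 := by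
  by_cases hl : l ∈ S
  · rw [h.succ_of_mem l hl]; omega
  · rw [h.succ_of_notMem l hl]; omega

theorem neg_le (h : IsWeight S w) (l : ℕ) : -(l : ℤ) ≤ w l := by
  induction l with
  | zero => simp [h.zero]
  | succ l ih =>
    have := h.le_succ l
    push_cast
    omega

theorem bddBelow (h : IsWeight S w) {c : ℕ} (hc : ∀ x, c ≤ x → x ∈ S) (l : ℕ) :
    -(c : ℤ) ≤ w l := by
  rcases le_total l c with hl | hl
  · have := h.neg_le l
    omega
  · obtain ⟨k, rfl⟩ := Nat.exists_eq_add_of_le hl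
    clear hl
    induction k with
    | zero => exact h.neg_le c
    | succ k ih =>
      rw [← add_assoc, h.succ_of_mem _ (hc _ (by omega))]
      omega

/-- The weight function of a symmetric semigroup is symmetric. -/
theorem symm (h : IsWeight S w) {c : ℕ} (hs : ∀ x y, x + y + 1 = c → (x ∈ S ↔ y ∉ S))
    {x y : ℕ} (hxy : x + y = c) : w x = w y := by
  -- By symmetry of `S`, both weights change equally when `x` goes up and `y` goes down. Evaluating
  -- at `(c, 0)` shows that the constant difference is its own negative.
  have hdiff : ∀ x y, x + y = c → w x - w y = w 0 - w c := by
    intro x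
    induction x with
    | zero => intro y hy; rw [show y = c by omega]
    | succ x ih =>
      intro y hy
      have h1 := ih (y + 1) (by omega)
      have h2 := hs x y (by omega)
      by_cases hx : x ∈ S
      · have h3 := h.succ_of_mem x hx
        have h4 := h.succ_of_notMem y (h2.1 hx)
        omega
      · have h3 := h.succ_of_notMem x hx
        have h4 := h.succ_of_mem y (by
          by_contra hy'
          exact hx (h2.2 hy'))
        omega
  have h1 := hdiff x y hxy
  have h2 := hdiff c 0 (by omega)
  omega

/-! ### Semigroups with odd elements from `b` on and all even numbers from `b - 1` on -/

section EvenOdd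

variable {b : ℕ} (hb : Odd b) (hodd : ∀ s ∈ S, Odd s → b ≤ s)
  (heven : ∀ x, Even x → b ≤ x + 1 → x ∈ S)

/-- Before `b` an odd step descends. An even step starts at an even weight, hence strictly below the
odd bound `n`, so it cannot exceed `n`. -/
theorem le_of_le_before (h : IsWeight S w) (hodd : ∀ s ∈ S, Odd s → b ≤ s) {n : ℤ} (hn : Odd n)
    {p r : ℕ} (hpr : p ≤ r) (hr : r < b) (hp : w p ≤ n) : w r ≤ n := by
  induction r, hpr using Nat.le_induction with
  | base => exact hp
  | succ r hpr ih =>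
    have h1 := ih (by omega)
    rcases Nat.even_or_odd r with he | ho
    · have h2 := (h.even_iff r).2 he
      have h3 := h.succ_le r
      rcases h1.eq_or_lt with h4 | h4
      · rw [h4, ← Int.not_odd_iff_even] at h2
        exact absurd hn h2
      · omega
    · have hnot : r ∉ S := fun hr' => by
        have := hodd r hr' ho
        omega
      rw [h.succ_of_notMem r hnot]
      omega

/-- The mirror image, read downwards from `q`: even steps ascend, and an odd step ends at an even
weight, strictly below `n`. -/
theorem le_of_le_after (h : IsWeight S w) (heven : ∀ x, Even x → b ≤ x + 1 → x ∈ S) {n : ℤ}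
    (hn : Odd n) {r q : ℕ} (hrq : r ≤ q) (hr : b ≤ r + 1) (hq : w q ≤ n) : w r ≤ n := by
  obtain ⟨k, rfl⟩ := Nat.exists_eq_add_of_le hrq
  clear hrq
  induction k with
  | zero => exact hq
  | succ k ih =>
    refine ih ?_
    rw [← add_assoc] at hq
    rcases Nat.even_or_odd (r + k) with he | ho
    · have h2 := h.succ_of_mem _ (heven (r + k) he (by omega))
      omega
    · have h2 := (h.even_iff (r + k + 1)).2 (Nat.even_add_one.2 (Nat.not_even_iff_odd.2 ho))
      have h3 := h.le_succ (r + k)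
      rcases hq.eq_or_lt with h4 | h4
      · rw [h4, ← Int.not_odd_iff_even] at h2
        exact absurd hn h2
      · omega

-- The point `b - 1` lies in the range of both one-sided lemmas. A smaller weight elsewhere would
-- contradict one of them at the odd height `w (b - 1) - 1`.
include hb hodd heven in
theorem apply_pred_le (h : IsWeight S w) (l : ℕ) : w (b - 1) ≤ w l := by
  by_contra hc
  have hb0 := hb.pos
  have he : Even (w (b - 1)) := (h.even_iff _).2 (Nat.Odd.sub_odd hb odd_one)
  have hn : Odd (w (b - 1) - 1) := he.sub_odd odd_one
  rcases le_total l (b - 1) with hl | hl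
  · have := h.le_of_le_before hodd hn hl (by omega) (by omega)
    omega
  · have := h.le_of_le_after heven hn hl (by omega) (by omega)
    omega

include hodd heven in
theorem isPreconnected_sublevel (h : IsWeight S w) {n : ℤ} (hn : Odd n) :
    IsPreconnected (sublevel w n) := by
  refine (ordConnected_sublevel fun p r q hpr hrq hp hq => ?_).isPreconnected
  rcases lt_or_ge r b with hr | hr
  · exact h.le_of_le_before hodd hn hpr hr hp
  · exact h.le_of_le_after heven hn hrq (by omega) hq

include hb hodd heven in
theorem oddRanksOne (h : IsWeight S w) : OddRanksOne w := by
  refine ⟨w (b - 1), ⟨⟨_, rfl⟩, ?_⟩, (h.even_iff _).2 (Nat.Odd.sub_odd hb odd_one), fun k hk => ?_⟩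
  · rintro _ ⟨l, rfl⟩
    exact h.apply_pred_le hb hodd heven l
  · exact finrank_eq_one_of_isPreconnected
      (h.isPreconnected_sublevel hodd heven (odd_two_mul_add_one k))
      (x := ((b - 1 : ℕ) : ℝ)) (natCast_mem_sublevel.2 (by omega))

-- An integer point `l` of the component that attains the odd level is odd. If `l ∈ S`, then `l - 1`
-- is an even number in the full range and lies one lower; otherwise `l + 1` does. Either neighbour
-- stays in the component.
include hodd heven in
theorem exists_isChild_of_odd (h : IsWeight S w) (v : RootVertex w) (hv : Odd v.chi) :
    ∃ u, IsChild u v := by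
  obtain ⟨x, hx⟩ := v.exists_mem
  have hxs := v.comp_subset hx
  have hfl := Nat.floor_le (mem_sublevel_iff.1 hxs).1
  have hf : (⌊x⌋₊ : ℝ) ∈ v.comp :=
    v.subset_comp isPreconnected_Icc (Icc_floor_subset_sublevel hxs)
      (Set.right_mem_Icc.2 hfl) hx (Set.left_mem_Icc.2 hfl)
  generalize ⌊x⌋₊ = l at hf
  have hl := natCast_mem_sublevel.1 (v.comp_subset hf)
  suffices ∃ y : ℕ, (y : ℝ) ∈ v.comp ∧ w y ≤ v.chi - 1 by
    obtain ⟨y, hy, hy'⟩ := this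
    exact ⟨_, isChild_vertexAt v (n := v.chi - 1) (by omega) hy (natCast_mem_sublevel.2 hy')⟩
  rcases hl.eq_or_lt with heq | hlt
  swap
  · exact ⟨l, hf, by omega⟩
  have hlo : Odd l := by
    rw [← Nat.not_even_iff_odd, ← h.even_iff, heq, Int.not_even_iff_odd]
    exact hv
  by_cases hlS : l ∈ S
  · have hbl := hodd l hlS hlo
    obtain ⟨k, rfl⟩ : ∃ k, l = k + 1 := ⟨l - 1, by have := hlo.pos; omega⟩
    have hk : Even k := by
      rw [← Nat.not_odd_iff_even]
      intro hk
      exact Nat.not_even_iff_odd.2 hlo hk.add_one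
    have h1 := h.succ_of_mem k (heven k hk hbl)
    have hle : (k : ℝ) ≤ ((k + 1 : ℕ) : ℝ) := by exact_mod_cast Nat.le_succ k
    exact ⟨k, v.subset_comp isPreconnected_Icc (Icc_subset_sublevel (by omega) hl)
      (Set.right_mem_Icc.2 hle) hf (Set.left_mem_Icc.2 hle), by omega⟩
  · have h1 := h.succ_of_notMem l hlS
    have hle : (l : ℝ) ≤ ((l + 1 : ℕ) : ℝ) := by exact_mod_cast Nat.le_succ l
    exact ⟨l + 1, v.subset_comp isPreconnected_Icc (Icc_subset_sublevel hl (by omega))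
      (Set.left_mem_Icc.2 hle) hf (Set.right_mem_Icc.2 hle), by omega⟩

-- Each odd level not below the minimum carries a single vertex, the whole sublevel set. The only
-- leaf of the trimmed root is the vertex one above the minimum: any higher vertex with a child
-- contains `b - 1` and so has a child that is not a leaf.
include hb hodd heven in
theorem rootEvenTrimmedPath (h : IsWeight S w) : RootEvenTrimmedPath w := by
  have hmin := h.apply_pred_le hb hodd heven
  have hmu : Even (w (b - 1)) := (h.even_iff _).2 (Nat.Odd.sub_odd hb odd_one)
  have hmem : ∀ {n : ℤ}, w (b - 1) ≤ n → ((b - 1 : ℕ) : ℝ) ∈ sublevel w n :=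
    fun hn => natCast_mem_sublevel.2 hn
  have hwhole : ∀ v : RootVertex w, Odd v.chi → v.comp = sublevel w v.chi := by
    intro v hv
    obtain ⟨x, hx⟩ := v.exists_mem
    rw [v.comp_eq hx]
    exact (h.isPreconnected_sublevel hodd heven hv).connectedComponentIn (v.comp_subset hx)
  constructor
  · intro v hv
    by_contra hne
    obtain ⟨u, hu⟩ := h.exists_isChild_of_odd hodd heven v (Int.not_even_iff_odd.1 hne)
    exact isLocalMin_iff.1 hv u hu
  have hbase : ∀ {n : ℤ} (hn : w (b - 1) + 1 ≤ n),
      ¬ IsLeaf (gradedRoot w) (vertexAt n _ (hmem (n := n) (by omega))) := fun {n} hn hleaf =>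
    isLeaf_iff.1 hleaf _ (isChild_vertexAt (n := n - 1) _ (sub_add_cancel n 1).symm
      (mem_vertexAt _) (hmem (by omega)))
  refine ⟨⟨vertexAt (w (b - 1) + 1) _ (hmem (by omega)), hbase le_rfl⟩, ?_, ?_⟩
  · refine isLeaf_trim_iff.2 fun u hu => isLeaf_iff.2 fun t ht => ?_
    have h1 := le_chi hmin t
    have h2 := ht.1
    have h3 : w (b - 1) + 1 = u.chi + 1 := hu.1
    omega
  · rintro ⟨v, hv⟩ hleaf
    rw [isLeaf_trim_iff] at hleaf
    have hv' := hv
    rw [isLeaf_iff] at hv'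
    push Not at hv'
    obtain ⟨u, hu⟩ := hv'
    have h1 := le_chi hmin u
    have h2 := hu.1
    rcases (show v.chi = w (b - 1) + 1 ∨ w (b - 1) + 2 ≤ v.chi by omega) with hchi | hchi
    · refine Subtype.ext (RootVertex.ext hchi ?_)
      have ho : Odd (w (b - 1) + 1) := hmu.add_one
      exact (hwhole v (hchi ▸ ho)).trans ((congrArg (sublevel w) hchi).trans
        (hwhole (vertexAt (w (b - 1) + 1) _ (hmem (by omega))) ho).symm)
    · exfalso
      -- Of `v` and its child `u`, the one at odd level is a whole sublevel set.
      have hbv : ((b - 1 : ℕ) : ℝ) ∈ v.comp := by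
        rcases Int.even_or_odd v.chi with he | ho
        · refine hu.2 ?_
          rw [hwhole u (by rw [h2, Int.even_add_one, Int.not_even_iff_odd] at he; exact he)]
          exact hmem h1
        · rw [hwhole v ho]
          exact hmem (by omega)
      exact hbase (n := v.chi - 1) (by omega)
        (hleaf _ (isChild_vertexAt v (by omega) hbv (hmem (by omega))))

end EvenOdd

/-! ### Obstructions -/

/-- An odd valley contradicts both conditions. -/
theorem not_of_odd_valley (h : IsWeight S w) {s : ℕ} (hs : Odd s) (hsS : s ∈ S)
    (hsS' : s - 1 ∉ S) : ¬ OddRanksOne w ∧ ¬ RootEvenTrimmedPath w := by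
  have hs0 := hs.pos
  have hodd : Odd (w s) := by
    rw [← Int.not_even_iff_odd, h.even_iff, Nat.not_even_iff_odd]
    exact hs
  have h1 := h.succ_of_mem s hsS
  have h2 := h.succ_of_notMem _ hsS'
  rw [Nat.sub_add_cancel hs0] at h2
  constructor
  · rintro ⟨c, ⟨⟨L, hL⟩, hc⟩, hce, hrank⟩
    have hcs := hc ⟨s, rfl⟩
    have hne : c ≠ w s := by
      rintro rfl
      exact Int.not_even_iff_odd.2 hodd hce
    obtain ⟨k, hk⟩ := hodd
    have hr := hrank k (by omega)
    rw [← hk] at hr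
    have hLs : L ≠ s := by rintro rfl; exact hne hL.symm
    -- The neighbours of `s` have weight `w s + 1`, so the minimum point `L` lies beyond one of
    -- them, and that neighbour separates it from `s`.
    rcases lt_or_gt_of_ne hLs with hlt | hgt
    · have hLs' : L ≠ s - 1 := by rintro rfl; omega
      exact finrank_ne_one_of_separated (p := L) (r := s - 1) (q := s) (by omega) (by omega)
        (by omega) le_rfl (by omega) hr
    · have hLs' : L ≠ s + 1 := by rintro rfl; omega
      exact finrank_ne_one_of_separated (p := s) (r := s + 1) (q := L) (by omega) (by omega)
        le_rfl (by omega) (by omega) hr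
  · rintro ⟨hloc, -⟩
    have hsmem : (s : ℝ) ∈ sublevel w (w s) := natCast_mem_sublevel.2 le_rfl
    refine Int.not_even_iff_odd.2 hodd (hloc (vertexAt (w s) s hsmem) ?_)
    rw [isLocalMin_iff]
    intro u hu
    have hchi : w s = u.chi + 1 := hu.1
    obtain ⟨x, hx⟩ := u.exists_mem
    have hxv := hu.2 hx
    have hsv : (s : ℝ) ∈ (vertexAt (w s) (s : ℝ) hsmem).comp := mem_vertexAt hsmem
    obtain ⟨hx0, hf, hc⟩ := mem_sublevel_iff.1 (u.comp_subset hx)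
    have hord := (vertexAt (w s) (s : ℝ) hsmem).isPreconnected.ordConnected
    have hno : ∀ y : ℕ, (y : ℝ) ∈ (vertexAt (w s) (s : ℝ) hsmem).comp → w y ≤ w s :=
      fun y hy => natCast_mem_sublevel.1 (RootVertex.comp_subset _ hy)
    -- The weight at `x` is below `w s`, so `x` is at least one unit away from `s`. The component
    -- would then contain `s + 1` or `s - 1`, whose weight is too large.
    rcases le_total (s : ℝ) x with hle | hle
    · have hfs : s ≤ ⌊x⌋₊ := Nat.le_floor hle
      have hne : ⌊x⌋₊ ≠ s := by intro he; rw [he] at hf; omega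
      have h4 : ((s + 1 : ℕ) : ℝ) ≤ x := (Nat.le_floor_iff hx0).1 (by omega)
      have := hno (s + 1) (hord.out hsv hxv ⟨by exact_mod_cast Nat.le_succ s, h4⟩)
      omega
    · have hfs : ⌈x⌉₊ ≤ s := Nat.ceil_le.2 hle
      have hne : ⌈x⌉₊ ≠ s := by intro he; rw [he] at hc; omega
      have h4 : x ≤ ((s - 1 : ℕ) : ℝ) := Nat.ceil_le.1 (by omega)
      have := hno (s - 1) (hord.out hxv hsv ⟨h4, by exact_mod_cast Nat.sub_le s 1⟩)
      omega

/-- Two separated valleys contradict both conditions. -/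
theorem not_of_separated (h : IsWeight S w) {c : ℤ} (hc : ∀ l, c ≤ w l) {p r q : ℕ} (hpe : Even p)
    (hpr : p < r) (hrq : r < q) (hpq : w p = w q) (hr : w p + 1 < w r) :
    ¬ OddRanksOne w ∧ ¬ RootEvenTrimmedPath w := by
  obtain ⟨k, hk⟩ := (h.even_iff p).2 hpe
  constructor
  · rintro ⟨c, ⟨-, hc⟩, -, hrank⟩
    have h1 := hrank k (by have := hc ⟨p, rfl⟩; omega)
    exact finrank_ne_one_of_separated hpr hrq (by omega) (by omega) (by omega) h1
  · rintro ⟨-, t, -, huniq⟩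
    have hmem : ∀ x, w x = w p → (x : ℝ) ∈ sublevel w (w p + 1) := fun x hx =>
      natCast_mem_sublevel.2 (by omega)
    have hleaf : ∀ x (hx : w x = w p), ¬ IsLeaf (gradedRoot w) (vertexAt (w p + 1) x (hmem x hx)) :=
      fun x hx hl => isLeaf_iff.1 hl _ (isChild_vertexAt (n := w p) _ rfl (mem_vertexAt _)
        (natCast_mem_sublevel.2 hx.le))
    -- Below the components of `p` and of `q` there are leaves of the trimmed root. If these agree,
    -- the components meet, hence coincide and contain `r`.
    obtain ⟨t1, ht1, hs1⟩ := exists_isLeaf_trim hc _ (hleaf p rfl)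
    obtain ⟨t2, ht2, hs2⟩ := exists_isLeaf_trim hc _ (hleaf q hpq.symm)
    have ht : t1 = t2 := (huniq t1 ht1).trans (huniq t2 ht2).symm
    obtain ⟨x, hx⟩ := t1.1.exists_mem
    have hx1 := hs1 hx
    have hx2 := hs2 (ht ▸ hx)
    have hcomp : (vertexAt (w p + 1) (p : ℝ) (hmem p rfl)).comp =
        (vertexAt (w p + 1) (q : ℝ) (hmem q hpq.symm)).comp :=
      (RootVertex.comp_eq _ hx1).trans (RootVertex.comp_eq _ hx2).symm
    have hq1 : (q : ℝ) ∈ (vertexAt (w p + 1) (p : ℝ) (hmem p rfl)).comp := by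
      rw [hcomp]
      exact mem_vertexAt _
    have hrm := (RootVertex.isPreconnected _).ordConnected.out
      (mem_vertexAt (hmem p rfl)) hq1 (show (r : ℝ) ∈ Set.Icc (p : ℝ) q from
        ⟨by exact_mod_cast hpr.le, by exact_mod_cast hrq.le⟩)
    have := natCast_mem_sublevel.1 (RootVertex.comp_subset _ hrm)
    change w r ≤ w p + 1 at this
    omega

end IsWeight

/-! ## The `ℤ[U]`-module -/

section Module

variable {w : ℕ → ℤ}

theorem actU_homog (n : ℤ) (f : H0 w n) :
    actU w (homog w n f) = homog w (n - 1) (restrict w (sub_le_self n zero_le_one) f) := by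
  rw [actU, homog, DirectSum.toModule_lof]
  rfl

/-- A constant extends to every higher level, so it is obtained from a positive level by repeated
action of `U`. -/
theorem homog_const_mem_towerSubmodule (n : ℤ) (c : ℤ) :
    homog w n (LocallyConstant.const _ c) ∈ towerSubmodule w := by
  rw [towerSubmodule, Submodule.mem_sInf]
  rintro N ⟨hN, hU⟩
  have key : ∀ k : ℕ, ∀ n : ℤ, 0 < n + k → homog w n (LocallyConstant.const _ c) ∈ N := by
    intro k
    induction k with
    | zero => intro n hn; exact hN n (by simpa using hn) ⟨_, rfl⟩
    | succ k ih =>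
      intro n hn
      have h1 := hU (ih (n + 1) (by push_cast at hn; omega))
      rw [Submodule.mem_comap, actU_homog] at h1
      have e : n + 1 - 1 = n := by omega
      have h2 : restrict w (sub_le_self (n + 1) zero_le_one) (LocallyConstant.const _ c) =
        LocallyConstant.const _ c := rfl
      rw [h2] at h1
      generalize n + 1 - 1 = n' at h1 e
      subst e
      exact h1
  exact key (1 - n).toNat n (by omega)

theorem actU_mem_towerSubmodule {x : LatticeH0 w} (hx : x ∈ towerSubmodule w) :
    actU w x ∈ towerSubmodule w := by
  rw [towerSubmodule, Submodule.mem_sInf] at hx ⊢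
  rintro N hN
  exact hN.2 (hx N hN)

theorem OddRanksOne.exists_eq_const (h : OddRanksOne w) {n : ℤ} (hn : Odd n) (f : H0 w n) :
    ∃ c, f = LocallyConstant.const _ c := by
  obtain ⟨m, ⟨⟨L, hL⟩, hm⟩, hme, hrank⟩ := h
  by_cases hle : m ≤ n
  · have hLn : (L : ℝ) ∈ sublevel w n := natCast_mem_sublevel.2 (by omega)
    obtain ⟨k, rfl⟩ := hn
    obtain ⟨j, rfl⟩ := hme
    refine ⟨f ⟨L, hLn⟩, ?_⟩
    ext y
    exact apply_eq_of_finrank (hrank k (by omega)) f _ _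
  · refine ⟨0, ?_⟩
    ext y
    have h1 := (mem_sublevel_iff.1 y.2).2.1
    have h2 := hm ⟨⌊(y : ℝ)⌋₊, rfl⟩
    omega

/-- One of the levels `n` and `n - 1` is odd, so either the class or its image under `U` is
constant. -/
theorem OddRanksOne.range_actU_le (h : OddRanksOne w) :
    LinearMap.range (actU w) ≤ towerSubmodule w := by
  rintro _ ⟨x, rfl⟩
  induction x using DirectSum.induction_on with
  | zero => rw [map_zero]; exact zero_mem _
  | add x y hx hy => rw [map_add]; exact add_mem hx hy
  | of n f =>
    change actU w (homog w n f) ∈ towerSubmodule w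
    rcases Int.even_or_odd n with he | ho
    · rw [actU_homog]
      obtain ⟨c, hc⟩ := h.exists_eq_const (he.sub_odd odd_one)
        (restrict w (sub_le_self n zero_le_one) f)
      rw [hc]
      exact homog_const_mem_towerSubmodule _ _
    · obtain ⟨c, rfl⟩ := h.exists_eq_const ho f
      exact actU_mem_towerSubmodule (homog_const_mem_towerSubmodule _ _)

theorem OddRanksOne.even_of_actU_eq_zero (h : OddRanksOne w) (d : ℤ) (f : H0 w d) (hf : f ≠ 0)
    (hU : actU w (homog w d f) = 0) : Even d := by
  by_contra hd
  rw [Int.not_even_iff_odd] at hd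
  obtain ⟨c, rfl⟩ := h.exists_eq_const hd f
  obtain ⟨m, ⟨⟨L, hL⟩, hm⟩, hme, hrank⟩ := h
  rw [actU_homog] at hU
  have h0 : restrict w (sub_le_self d zero_le_one) (LocallyConstant.const _ c) = 0 := by
    refine DirectSum.of_injective (β := H0 w) (d - 1) ?_
    rw [map_zero]
    exact hU
  by_cases hle : m ≤ d - 1
  · have h1 := congrArg (fun g : H0 w (d - 1) => g ⟨L, natCast_mem_sublevel.2 (by omega)⟩) h0
    have hc : c = 0 := h1
    subst hc
    exact hf rfl
  -- Here `d - 1` is below the even minimum, and `d` is odd, so `d` is also below it and the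
  -- sublevel set is empty.
  · refine hf ?_
    ext y
    have h1 := (mem_sublevel_iff.1 y.2).2.1
    have h2 := hm ⟨⌊(y : ℝ)⌋₊, rfl⟩
    obtain ⟨j, hj⟩ := hd
    obtain ⟨i, hi⟩ := hme
    omega

end Module

/-! ## Orders of germs in one variable -/

section Order

theorem toGerm_eq_iff {E : Type} [NormedAddCommGroup E] [NormedSpace ℂ E]
    (f g : analyticFunctions E) : toGerm E f = toGerm E g ↔ ∀ᶠ x in 𝓝 (0 : E), f.1 x = g.1 x := by
  rw [← sub_eq_zero, ← map_sub, toGerm_eq_zero_iff]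
  refine Filter.eventually_congr (Filter.Eventually.of_forall fun x => ?_)
  exact sub_eq_zero

theorem ordGerm_eq_top_iff (a : HolGerm ℂ) : ordGerm a = ⊤ ↔ a = 0 := by
  obtain ⟨f, rfl⟩ := toGerm_surjective ℂ a
  rw [ordGerm_mk, analyticOrderAt_eq_top, toGerm_eq_zero_iff]

theorem ordGerm_algebraMap {c : ℂ} (hc : c ≠ 0) : ordGerm (algebraMap ℂ (HolGerm ℂ) c) = 0 := by
  rw [← (toGerm ℂ).commutes, ordGerm_mk, analyticOrderAt_eq_zero]
  exact Or.inr hc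

theorem ordGerm_pow (a : HolGerm ℂ) (n : ℕ) : ordGerm (a ^ n) = n * ordGerm a := by
  induction n with
  | zero => simp [ordGerm_one]
  | succ n ih => rw [pow_succ, ordGerm_mul, ih]; push_cast; ring

theorem ordGerm_add_of_lt {a b : HolGerm ℂ} (h : ordGerm a < ordGerm b) :
    ordGerm (a + b) = ordGerm a := by
  obtain ⟨f, rfl⟩ := toGerm_surjective ℂ a
  obtain ⟨g, rfl⟩ := toGerm_surjective ℂ b
  rw [← map_add, ordGerm_mk, ordGerm_mk] at *
  exact analyticOrderAt_add_eq_left_of_lt h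

/-- Cancellation of leading coefficients. -/
theorem exists_lt_ordGerm_sub {a b : HolGerm ℂ} {n : ℕ} (ha : ordGerm a = n) (hb : ordGerm b = n) :
    ∃ c : ℂ, (n : ℕ∞) < ordGerm (a - algebraMap ℂ _ c * b) := by
  obtain ⟨f, rfl⟩ := toGerm_surjective ℂ a
  obtain ⟨g, rfl⟩ := toGerm_surjective ℂ b
  rw [ordGerm_mk] at ha hb
  obtain ⟨F, hF, hF0, hfF⟩ := (AnalyticAt.analyticOrderAt_eq_natCast f.2).1 ha
  obtain ⟨G, hG, hG0, hgG⟩ := (AnalyticAt.analyticOrderAt_eq_natCast g.2).1 hb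
  refine ⟨F 0 / G 0, ?_⟩
  rw [← (toGerm ℂ).commutes, ← map_mul, ← map_sub, ordGerm_mk]
  have hH : AnalyticAt ℂ (fun z => F z - F 0 / G 0 * G z) 0 :=
    hF.sub (analyticAt_const.mul hG)
  have hcongr : (f - algebraMap ℂ (analyticFunctions ℂ) (F 0 / G 0) * g).1 =ᶠ[𝓝 0]
      (id : ℂ → ℂ) ^ n * fun z => F z - F 0 / G 0 * G z := by
    filter_upwards [hfF, hgG] with z hf hg
    change f.1 z - F 0 / G 0 * g.1 z = z ^ n * (F z - F 0 / G 0 * G z)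
    rw [hf, hg, sub_zero, smul_eq_mul, smul_eq_mul]
    ring
  rw [analyticOrderAt_congr hcongr, analyticOrderAt_mul (analyticAt_id.pow n) hH,
    analyticOrderAt_pow analyticAt_id, analyticOrderAt_id, nsmul_one]
  have h1 : analyticOrderAt (fun z => F z - F 0 / G 0 * G z) 0 ≠ 0 := by
    rw [analyticOrderAt_ne_zero]
    exact ⟨hH, by field_simp; ring⟩
  have h2 : (1 : ℕ∞) ≤ analyticOrderAt (fun z => F z - F 0 / G 0 * G z) 0 :=
    Order.one_le_iff_ne_zero.2 h1
  calc (n : ℕ∞) < n + 1 := by exact_mod_cast Nat.lt_succ_self n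
    _ ≤ _ := by gcongr

end Order

/-! ## Values of bivariate polynomials -/

section Bivariate

open Polynomial

variable (x y : HolGerm ℂ)

/-- Substitution of two germs into a polynomial in two variables. -/
def bieval : ℂ[X][X] →+* HolGerm ℂ :=
  eval₂RingHom (aeval x : ℂ[X] →ₐ[ℂ] HolGerm ℂ).toRingHom y

@[simp] theorem bieval_X : bieval x y X = y := by simp [bieval]

@[simp] theorem bieval_C (p : ℂ[X]) : bieval x y (C p) = aeval x p := by simp [bieval]

/-- `a` is the largest order of the value of a monic polynomial of degree `k`. -/
def IsMaxVal (k a : ℕ) : Prop :=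
  (∃ P : ℂ[X][X], P.Monic ∧ P.natDegree = k ∧ ordGerm (bieval x y P) = a) ∧
    ∀ P : ℂ[X][X], P.Monic → P.natDegree = k → ordGerm (bieval x y P) ≤ a

variable {x y} {m : ℕ}

theorem ordGerm_aeval (hx : ordGerm x = m) (hm : 0 < m) {p : ℂ[X]} (hp : p ≠ 0) :
    ∃ l : ℕ, ordGerm (aeval x p) = (m * l : ℕ) := by
  obtain ⟨q, hpq, hq⟩ := exists_eq_pow_rootMultiplicity_mul_and_not_dvd p hp 0
  rw [C_0, sub_zero] at hpq hq
  rw [X_dvd_iff] at hq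
  refine ⟨rootMultiplicity 0 p, ?_⟩
  have h0 : ordGerm (aeval x q) = 0 := by
    rw [← divX_mul_X_add q, map_add, map_mul, aeval_X, aeval_C, add_comm, ordGerm_add_of_lt,
      ordGerm_algebraMap hq]
    rw [ordGerm_algebraMap hq, ordGerm_mul, hx]
    refine lt_of_lt_of_le ?_ le_add_self
    exact_mod_cast hm
  conv_lhs => rw [hpq]
  rw [map_mul, map_pow, aeval_X, ordGerm_mul, ordGerm_pow, hx, h0]
  push_cast
  ring

/-- Expanding `Q` in the monic polynomials `P` of degrees `i < k`, the nonzero terms have orders in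
distinct classes modulo `m`. No cancellation occurs, and the order of the sum is the least of them.
-/
theorem ordGerm_of_degree_lt (hx : ordGerm x = m) (hm : 0 < m) {a : ℕ → ℕ} (k : ℕ)
    (ha : ∀ i < k, ∃ P : ℂ[X][X], P.Monic ∧ P.natDegree = i ∧ ordGerm (bieval x y P) = a i)
    (hinj : ∀ i < k, ∀ j < k, (a i : ZMod m) = a j → i = j) (Q : ℂ[X][X]) (hQ : Q ≠ 0)
    (hdeg : Q.degree < k) : ∃ i < k, ∃ l, ordGerm (bieval x y Q) = (a i + m * l : ℕ) := by
  induction k generalizing Q with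
  | zero =>
    exfalso
    exact hQ (degree_lt_iff_coeff_zero _ _ |>.1 hdeg |> fun h => ext fun n => h n (Nat.zero_le n))
  | succ k ih =>
    have ih' := ih (fun i hi => ha i (by omega)) (fun i hi j hj => hinj i (by omega) j (by omega))
    obtain ⟨P, hP, hPk, hPa⟩ := ha k (by omega)
    rw [degree_lt_iff_coeff_zero] at hdeg
    set c := Q.coeff k with hc
    have hdeg' : (Q - C c * P).degree < k := by
      rw [degree_lt_iff_coeff_zero]
      intro j hj
      rw [coeff_sub, coeff_C_mul]
      rcases hj.eq_or_lt with rfl | hlt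
      · have : P.coeff k = 1 := by rw [← hPk]; exact hP.coeff_natDegree
        rw [this, hc, mul_one, sub_self]
      · rw [hdeg j hlt, coeff_eq_zero_of_natDegree_lt (by omega), mul_zero, sub_zero]
    by_cases hc0 : c = 0
    · rw [hc0, C_0, zero_mul, sub_zero] at hdeg'
      obtain ⟨i, hi, l, hl⟩ := ih' Q hQ hdeg'
      exact ⟨i, by omega, l, hl⟩
    obtain ⟨l, hl⟩ := ordGerm_aeval hx hm hc0
    have hcP : ordGerm (bieval x y (C c * P)) = (a k + m * l : ℕ) := by
      rw [map_mul, ordGerm_mul, bieval_C, hl, hPa]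
      push_cast
      ring
    have hQe : bieval x y Q = bieval x y (C c * P) + bieval x y (Q - C c * P) := by
      rw [← map_add]
      congr 1
      ring
    by_cases hQ' : Q - C c * P = 0
    · exact ⟨k, by omega, l, by rw [hQe, hQ', map_zero, add_zero, hcP]⟩
    obtain ⟨i, hi, l', hl'⟩ := ih' _ hQ' hdeg'
    rcases lt_trichotomy (a k + m * l) (a i + m * l') with hlt | heq | hgt
    · refine ⟨k, by omega, l, ?_⟩
      rw [hQe, ordGerm_add_of_lt, hcP]
      rw [hcP, hl']
      exact_mod_cast hlt
    · have := hinj k (by omega) i (by omega) (by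
        have := congrArg (Nat.cast : ℕ → ZMod m) heq
        simpa using this)
      omega
    · refine ⟨i, by omega, l', ?_⟩
      rw [hQe, add_comm, ordGerm_add_of_lt, hl']
      rw [hcP, hl']
      exact_mod_cast hgt

/-- A monic polynomial can be modified in lower degrees so as to increase its order. -/
theorem exists_monic_lt (hx : ordGerm x = m) {P Q : ℂ[X][X]} {i k s l b : ℕ} (hP : P.Monic)
    (hPk : P.natDegree = k) (hQi : Q.natDegree = i) (hik : i < k)
    (hPs : ordGerm (bieval x y P) = s) (hQb : ordGerm (bieval x y Q) = b) (hs : s = b + m * l) :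
    ∃ P' : ℂ[X][X], P'.Monic ∧ P'.natDegree = k ∧ (s : ℕ∞) < ordGerm (bieval x y P') := by
  have hR : ordGerm (bieval x y (C (X ^ l) * Q)) = s := by
    rw [map_mul, ordGerm_mul, bieval_C, map_pow, aeval_X, ordGerm_pow, hx, hQb, hs]
    push_cast
    ring
  obtain ⟨c, hc⟩ := exists_lt_ordGerm_sub hPs hR
  have hdeg : (C (C c) * (C (X ^ l) * Q)).natDegree < P.natDegree :=
    ((natDegree_C_mul_le _ _).trans (natDegree_C_mul_le _ _)).trans_lt (by omega)
  refine ⟨P - C (C c) * (C (X ^ l) * Q), ?_, ?_, ?_⟩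
  · exact hP.sub_of_left (degree_lt_degree hdeg)
  · rw [natDegree_sub_eq_left_of_natDegree_lt hdeg, hPk]
  · rw [map_sub, map_mul _ (C (C c)), bieval_C, aeval_C]
    exact hc

theorem IsMaxVal.le_of_le {i k a b : ℕ} (hi : IsMaxVal x y i a) (hk : IsMaxVal x y k b)
    (hik : i ≤ k) : a ≤ b := by
  obtain ⟨P, hP, hPi, hPa⟩ := hi.1
  have h := hk.2 (X ^ (k - i) * P) ((monic_X_pow _).mul hP) (by
    rw [(monic_X_pow _).natDegree_mul hP, natDegree_X_pow, hPi]
    omega)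
  rw [map_mul, ordGerm_mul, hPa] at h
  exact_mod_cast le_add_self.trans h

/-- If the maxima were congruent, a multiple of `x ^ l` times the polynomial of degree `i` would
cancel the leading term in degree `k` and exceed the maximum. -/
theorem IsMaxVal.ne (hx : ordGerm x = m) {i k a b : ℕ} (hi : IsMaxVal x y i a)
    (hk : IsMaxVal x y k b) (hik : i < k) : (a : ZMod m) ≠ b := by
  intro hab
  have hle := hi.le_of_le hk hik.le
  obtain ⟨P, hP, hPk, hPb⟩ := hk.1
  obtain ⟨Q, -, hQi, hQa⟩ := hi.1
  obtain ⟨l, hl⟩ := (Nat.modEq_iff_dvd' hle).1 ((ZMod.natCast_eq_natCast_iff _ _ _).1 hab)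
  obtain ⟨P', hP', hPk', hlt⟩ := exists_monic_lt hx hP hPk hQi hik hPb hQa
    (l := l) (by omega)
  exact absurd (hk.2 P' hP' hPk') (not_le.2 hlt)

theorem IsMaxVal.injective (hx : ordGerm x = m) {a : ℕ → ℕ} {k : ℕ}
    (ha : ∀ i < k, IsMaxVal x y i (a i)) :
    ∀ i < k, ∀ j < k, (a i : ZMod m) = a j → i = j := by
  intro i hi j hj hij
  rcases lt_trichotomy i j with hlt | heq | hgt
  · exact absurd hij ((ha i hi).ne hx (ha j hj) hlt)
  · exact heq
  · exact absurd hij.symm ((ha j hj).ne hx (ha i hi) hgt)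

/-- If the orders of monic polynomials of degree `k` are unbounded, then all orders are accounted
for by polynomials of degree less than `k`. -/
theorem exists_eq_of_unbounded (hx : ordGerm x = m) (hm : 0 < m) {a : ℕ → ℕ} {k : ℕ}
    (ha : ∀ i < k, IsMaxVal x y i (a i))
    (hunb : ∀ N : ℕ, ∃ P : ℂ[X][X], P.Monic ∧ P.natDegree = k ∧ (N : ℕ∞) < ordGerm (bieval x y P))
    {G : ℂ[X][X]} {s : ℕ} (hG : ordGerm (bieval x y G) = s) :
    ∃ i < k, ∃ l, s = a i + m * l := by
  obtain ⟨P, hP, hPk, hlt⟩ := hunb s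
  -- Reduction modulo a monic `P` of order greater than `s` does not change the order `s` of `G`.
  have hdecomp := modByMonic_add_div G P
  set r := G %ₘ P with hr
  have hrG : r = G + -(P * (G /ₘ P)) := by linear_combination hdecomp
  have hval : ordGerm (bieval x y r) = s := by
    rw [hrG, map_add, ordGerm_add_of_lt, hG]
    rw [hG, map_neg, ← neg_one_mul, ordGerm_mul, map_mul, ordGerm_mul]
    exact hlt.trans_le (le_self_add.trans le_add_self)
  have hr0 : r ≠ 0 := by
    intro h0
    rw [h0, map_zero, ordGerm_zero] at hval
    exact ENat.natCast_ne_top s hval.symm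
  have hdeg : r.degree < k := by
    have := degree_modByMonic_lt G hP
    rwa [degree_eq_natDegree hP.ne_zero, hPk] at this
  obtain ⟨i, hi, l, hl⟩ := ordGerm_of_degree_lt hx hm k (fun i hi => (ha i hi).1)
    (IsMaxVal.injective hx ha) r hr0 hdeg
  exact ⟨i, hi, l, by rw [hval] at hl; exact_mod_cast hl⟩

/-- If orders in degree `k < m` were unbounded, the `k` lower maxima would meet all `m` residue
classes. -/
theorem exists_isMaxVal (hx : ordGerm x = m) (hm : 0 < m)
    (hres : ∀ r : ZMod m, ∃ (G : ℂ[X][X]) (s : ℕ), ordGerm (bieval x y G) = s ∧ (s : ZMod m) = r)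
    (k : ℕ) (hk : k < m) : ∃ a, IsMaxVal x y k a := by
  induction k using Nat.strong_induction_on with
  | _ k ih =>
  have : NeZero m := ⟨hm.ne'⟩
  choose! a ha using fun i (hi : i < k) => ih i hi (by omega)
  have hbdd : ∃ N : ℕ, ∀ P : ℂ[X][X], P.Monic → P.natDegree = k →
      ordGerm (bieval x y P) ≤ N := by
    by_contra hc
    push Not at hc
    have hcover : Function.Surjective fun i : Fin k => (a i : ZMod m) := by
      intro r
      obtain ⟨G, s, hG, hs⟩ := hres r
      obtain ⟨i, hi, l, hl⟩ := exists_eq_of_unbounded hx hm ha hc hG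
      refine ⟨⟨i, hi⟩, ?_⟩
      rw [← hs, hl]
      simp
    have := Fintype.card_le_of_surjective _ hcover
    rw [ZMod.card, Fintype.card_fin] at this
    omega
  obtain ⟨N, hN⟩ := hbdd
  set T : Set ℕ := {b | ∃ P : ℂ[X][X], P.Monic ∧ P.natDegree = k ∧ ordGerm (bieval x y P) = b}
  have hT : BddAbove T := ⟨N, by
    rintro b ⟨P, hP, hPk, hPb⟩
    have := hN P hP hPk
    rw [hPb] at this
    exact_mod_cast this⟩
  have hex : ∀ P : ℂ[X][X], P.Monic → P.natDegree = k →
      ∃ b ∈ T, ordGerm (bieval x y P) = b := by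
    intro P hP hPk
    obtain ⟨b, hb⟩ := ENat.ne_top_iff_exists.1
      (ne_top_of_le_ne_top (ENat.natCast_ne_top N) (hN P hP hPk))
    exact ⟨b, ⟨P, hP, hPk, hb.symm⟩, hb.symm⟩
  have hne : T.Nonempty := by
    obtain ⟨b, hb, -⟩ := hex (X ^ k) (monic_X_pow k) (natDegree_X_pow k)
    exact ⟨b, hb⟩
  refine ⟨sSup T, Nat.sSup_mem hne hT, fun P hP hPk => ?_⟩
  obtain ⟨b, hb, he⟩ := hex P hP hPk
  rw [he]
  exact_mod_cast le_csSup hT hb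

/-- In degree `m` all classes are available for cancellation: once the order is at least `a (m -
1)`, it has the form `a i + m * l` and can be raised. This replaces a Weierstrass equation of the
branch. -/
theorem unbounded_of_isMaxVal (hx : ordGerm x = m) (hm : 0 < m) {a : ℕ → ℕ}
    (ha : ∀ i < m, IsMaxVal x y i (a i)) (N : ℕ) :
    ∃ P : ℂ[X][X], P.Monic ∧ P.natDegree = m ∧ (N : ℕ∞) < ordGerm (bieval x y P) := by
  have : NeZero m := ⟨hm.ne'⟩
  have hinj : Function.Injective fun i : Fin m => (a i : ZMod m) :=
    fun i j hij => Fin.ext (IsMaxVal.injective hx ha i i.2 j j.2 hij)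
  have hsurj := ((Fintype.bijective_iff_injective_and_card _).2 ⟨hinj, by simp⟩).2
  have key : ∀ N : ℕ, ∃ P : ℂ[X][X], P.Monic ∧ P.natDegree = m ∧
      (a (m - 1) : ℕ∞) ≤ ordGerm (bieval x y P) ∧ (N : ℕ∞) ≤ ordGerm (bieval x y P) := by
    intro N
    induction N with
    | zero =>
      obtain ⟨P, hP, hPk, hPa⟩ := (ha (m - 1) (by omega)).1
      refine ⟨X * P, monic_X.mul hP, ?_, ?_, by simp⟩
      · rw [monic_X.natDegree_mul hP, natDegree_X, hPk]
        omega
      · rw [map_mul, ordGerm_mul, hPa]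
        exact le_add_self
    | succ N ih =>
      obtain ⟨P, hP, hPk, h1, h2⟩ := ih
      by_cases htop : ordGerm (bieval x y P) = ⊤
      · exact ⟨P, hP, hPk, h1, by rw [htop]; exact le_top⟩
      obtain ⟨s, hs⟩ := ENat.ne_top_iff_exists.1 htop
      obtain ⟨i, hi⟩ := hsurj (s : ZMod m)
      have hle : a i ≤ s := by
        rw [← hs] at h1
        have h3 := (ha i i.2).le_of_le (ha (m - 1) (by omega)) (by have := i.2; omega)
        have h4 : a (m - 1) ≤ s := by exact_mod_cast h1
        omega
      obtain ⟨l, hl⟩ := (Nat.modEq_iff_dvd' hle).1 ((ZMod.natCast_eq_natCast_iff _ _ _).1 hi)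
      obtain ⟨Q, -, hQi, hQa⟩ := (ha i i.2).1
      obtain ⟨P', hP', hPk', hlt⟩ := exists_monic_lt hx hP hPk hQi i.2 hs.symm hQa
        (l := l) (by omega)
      rw [hs] at hlt
      refine ⟨P', hP', hPk', h1.trans hlt.le, ?_⟩
      rw [Nat.cast_succ]
      exact Order.add_one_le_of_lt (h2.trans_lt hlt)
  obtain ⟨P, hP, hPk, -, h⟩ := key (N + 1)
  exact ⟨P, hP, hPk, lt_of_lt_of_le (by exact_mod_cast Nat.lt_succ_self N) h⟩

/-- The semigroup of orders of the values of polynomials at two germs has a superadditive Apéry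
sequence. -/
theorem exists_isAperySeq {S : AddSubmonoid ℕ}
    (hS : ∀ s : ℕ, s ∈ S ↔ ∃ P, ordGerm (bieval x y P) = s) (hm : 1 < m) (hx : ordGerm x = m)
    (hy : m ≤ ordGerm y) (hres : ∀ r : ZMod m, ∃ s ∈ S, (s : ZMod m) = r) :
    ∃ a, IsAperySeq S m a := by
  have hm0 : 0 < m := by omega
  have hres' : ∀ r : ZMod m, ∃ (G : ℂ[X][X]) (s : ℕ),
      ordGerm (bieval x y G) = s ∧ (s : ZMod m) = r := by
    intro r
    obtain ⟨s, hs, hr⟩ := hres r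
    obtain ⟨P, hP⟩ := (hS s).1 hs
    exact ⟨P, s, hP, hr⟩
  choose! a ha using exists_isMaxVal hx hm0 hres'
  have ha0 : a 0 = 0 := by
    obtain ⟨P, hP, hP0, hPa⟩ := (ha 0 hm0).1
    rw [eq_one_of_monic_natDegree_zero hP hP0, map_one, ordGerm_one] at hPa
    exact_mod_cast hPa.symm
  have hinj := IsMaxVal.injective hx ha
  refine ⟨a, hm, ha0, ?_, ?_, ?_, hinj⟩
  -- The polynomial `X` gives `a 1 ≥ m`; equality would put `a 1` in the class of `a 0`.
  · have h1 := (ha 1 hm).2 X monic_X natDegree_X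
    rw [bieval_X] at h1
    have h2 : m ≤ a 1 := by exact_mod_cast hy.trans h1
    refine lt_of_le_of_ne h2 fun he => ?_
    have := hinj 0 hm0 1 hm (by rw [ha0, ← he]; simp)
    omega
  · intro i j hij
    obtain ⟨P, hP, hPi, hPa⟩ := (ha i (by omega)).1
    obtain ⟨Q, hQ, hQj, hQa⟩ := (ha j (by omega)).1
    have := (ha (i + j) hij).2 (P * Q) (hP.mul hQ) (by rw [hP.natDegree_mul hQ, hPi, hQj])
    rw [map_mul, ordGerm_mul, hPa, hQa] at this
    exact_mod_cast this
  · intro s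
    constructor
    · intro hs
      obtain ⟨P, hP⟩ := (hS s).1 hs
      exact exists_eq_of_unbounded hx hm0 ha (unbounded_of_isMaxVal hx hm0 ha) hP
    · rintro ⟨i, hi, k, rfl⟩
      obtain ⟨P, -, -, hPa⟩ := (ha i hi).1
      refine (hS _).2 ⟨C (X ^ k) * P, ?_⟩
      rw [map_mul, ordGerm_mul, bieval_C, map_pow, aeval_X, ordGerm_pow, hx, hPa]
      push_cast
      ring

end Bivariate

/-! ## Polynomial approximation -/

section Approximation

/-- The first coordinate function on `ℂ × ℂ`. -/
def coordFst : analyticFunctions (ℂ × ℂ) := ⟨fun z => z.1, analyticAt_fst⟩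

/-- The second coordinate function on `ℂ × ℂ`. -/
def coordSnd : analyticFunctions (ℂ × ℂ) := ⟨fun z => z.2, analyticAt_snd⟩

/-- The restriction of a multilinear form to the diagonal is a polynomial. -/
theorem exists_polynomial_multilinear {k : ℕ}
    (p : ContinuousMultilinearMap ℂ (fun _ : Fin k => ℂ × ℂ) ℂ) :
    ∃ G ∈ Algebra.adjoin ℂ {coordFst, coordSnd}, ∀ z, G.1 z = p fun _ => z := by
  classical
  -- Multilinear expansion of `z = z.1 • (1, 0) + z.2 • (0, 1)`; `s` is the set of slots that
  -- receive the first vector.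
  refine ⟨∑ s : Finset (Fin k), (∏ i, if i ∈ s then coordFst else coordSnd) *
    algebraMap ℂ _ (p fun i => if i ∈ s then (1, 0) else (0, 1)), ?_, fun z => ?_⟩
  · refine Subalgebra.sum_mem _ fun s _ => Subalgebra.mul_mem _ (Subalgebra.prod_mem _ fun i _ => ?_)
      (Subalgebra.algebraMap_mem _ _)
    split_ifs
    · exact Algebra.subset_adjoin (by simp)
    · exact Algebra.subset_adjoin (by simp)
  · have hz : (fun _ : Fin k => z) =
        (fun _ => z.1 • ((1, 0) : ℂ × ℂ)) + (fun _ => z.2 • ((0, 1) : ℂ × ℂ)) := by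
      funext i
      ext <;> simp
    rw [hz, ContinuousMultilinearMap.map_add_univ]
    let ev : analyticFunctions (ℂ × ℂ) →+* ℂ :=
      (Pi.evalRingHom (fun _ : ℂ × ℂ => ℂ) z).comp (analyticFunctions (ℂ × ℂ)).val.toRingHom
    change ev _ = _
    rw [map_sum]
    refine Finset.sum_congr rfl fun s _ => ?_
    have hs : s.piecewise (fun _ => z.1 • ((1, 0) : ℂ × ℂ)) (fun _ => z.2 • ((0, 1) : ℂ × ℂ)) =
        fun i => (if i ∈ s then z.1 else z.2) • (if i ∈ s then ((1, 0) : ℂ × ℂ) else (0, 1)) := by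
      funext i
      by_cases hi : i ∈ s <;> simp [hi]
    rw [hs, ContinuousMultilinearMap.map_smul_univ, map_mul, map_prod, smul_eq_mul]
    refine congrArg₂ (· * ·) (Finset.prod_congr rfl fun i _ => ?_) rfl
    split_ifs <;> rfl

/-- Taylor polynomials of functions of two variables. -/
theorem exists_polynomial_isBigO (F : analyticFunctions (ℂ × ℂ)) (N : ℕ) :
    ∃ G ∈ Algebra.adjoin ℂ {coordFst, coordSnd},
      (fun z => (F - G).1 z) =O[𝓝 0] fun z => ‖z‖ ^ N := by
  obtain ⟨p, hp⟩ := F.2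
  choose G hG hGp using fun k => exists_polynomial_multilinear (p k)
  refine ⟨∑ k ∈ Finset.range N, G k, Subalgebra.sum_mem _ fun k _ => hG k, ?_⟩
  refine (hp.isBigO_sub_partialSum_pow N).congr_left fun z => ?_
  change F.1 (0 + z) - _ = F.1 z - (∑ k ∈ Finset.range N, G k).1 z
  rw [zero_add, FormalMultilinearSeries.partialSum]
  congr 1
  let ev : analyticFunctions (ℂ × ℂ) →+* ℂ :=
    (Pi.evalRingHom (fun _ : ℂ × ℂ => ℂ) z).comp (analyticFunctions (ℂ × ℂ)).val.toRingHom
  change _ = ev _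
  rw [map_sum]
  exact Finset.sum_congr rfl fun k _ => (hGp k z).symm

/-- If the order `k` were less than `N`, division by `t ^ k` would force the nonvanishing factor to
tend to zero. -/
theorem le_analyticOrderAt_of_isBigO {f : ℂ → ℂ} (hf : AnalyticAt ℂ f 0) {N : ℕ}
    (h : f =O[𝓝 0] fun t => ‖t‖ ^ N) : (N : ℕ∞) ≤ analyticOrderAt f 0 := by
  by_contra hlt
  rw [not_le] at hlt
  obtain ⟨k, hk⟩ := ENat.ne_top_iff_exists.1 hlt.ne_top
  rw [← hk] at hlt
  have hkN : k < N := by exact_mod_cast hlt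
  obtain ⟨g, hg, hg0, hfg⟩ := (AnalyticAt.analyticOrderAt_eq_natCast hf).1 hk.symm
  obtain ⟨c, hc⟩ := h.bound
  have hne : ∀ᶠ t : ℂ in 𝓝[≠] 0, ‖g t‖ ≤ c * ‖t‖ ^ (N - k) := by
    filter_upwards [hc.filter_mono nhdsWithin_le_nhds, hfg.filter_mono nhdsWithin_le_nhds,
      self_mem_nhdsWithin] with t h1 h2 h3
    have ht : 0 < ‖t‖ := norm_pos_iff.2 h3
    rw [h2, sub_zero, norm_smul, norm_pow, norm_pow, norm_norm,
      ← Nat.add_sub_of_le hkN.le, pow_add] at h1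
    have h4 : ‖t‖ ^ k * ‖g t‖ ≤ ‖t‖ ^ k * (c * ‖t‖ ^ (N - k)) := by linarith
    exact le_of_mul_le_mul_left h4 (pow_pos ht k)
  have hl : Filter.Tendsto (fun t => ‖g t‖) (𝓝[≠] 0) (𝓝 ‖g 0‖) :=
    (hg.continuousAt.norm.tendsto).mono_left nhdsWithin_le_nhds
  have hr : Filter.Tendsto (fun t : ℂ => c * ‖t‖ ^ (N - k)) (𝓝[≠] 0) (𝓝 0) := by
    have hcont : Continuous fun t : ℂ => c * ‖t‖ ^ (N - k) := by fun_prop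
    have h0 := (hcont.tendsto 0).mono_left (nhdsWithin_le_nhds (s := {0}ᶜ))
    simpa [zero_pow (show N - k ≠ 0 by omega)] using h0
  have := le_of_tendsto_of_tendsto hl hr hne
  exact hg0 (norm_le_zero_iff.1 this)

end Approximation

namespace Arc

variable {C : IrredGerm} (γ : Arc C)

/-- The first coordinate of an arc. -/
def xGerm : HolGerm ℂ := toGerm ℂ (γ.compFun coordFst)

/-- The second coordinate of an arc. -/
def yGerm : HolGerm ℂ := toGerm ℂ (γ.compFun coordSnd)

/-- The class in the local algebra of a function of two variables. -/
def toLocalRing (C : IrredGerm) : analyticFunctions (ℂ × ℂ) →ₐ[ℂ] C.LocalRing :=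
  (Ideal.Quotient.mkₐ ℂ (Ideal.span {germ C.f C.analytic})).comp (toGerm (ℂ × ℂ))

theorem toLocalRing_surjective : Function.Surjective (toLocalRing C) :=
  (Ideal.Quotient.mkₐ_surjective ℂ _).comp (toGerm_surjective _)

theorem pullback_toLocalRing (F : analyticFunctions (ℂ × ℂ)) :
    γ.pullback (toLocalRing C F) = toGerm ℂ (γ.compFun F) := rfl

theorem map_adjoin_coord :
    (Algebra.adjoin ℂ {coordFst, coordSnd}).map ((toGerm ℂ).comp γ.compFun) =
      Algebra.adjoin ℂ {γ.xGerm, γ.yGerm} := by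
  rw [AlgHom.map_adjoin, Set.image_pair]
  rfl

/-- The values of functions are the values of polynomials. -/
theorem mem_semigroup_iff_adjoin (s : ℕ) :
    s ∈ γ.semigroup ↔ ∃ g ∈ Algebra.adjoin ℂ {γ.xGerm, γ.yGerm}, ordGerm g = s := by
  constructor
  · rintro ⟨g, hg⟩
    obtain ⟨F, rfl⟩ := toLocalRing_surjective g
    -- With exponent `s + 1` the error has order greater than `s` on the arc and does not affect the
    -- value.
    obtain ⟨G, hG, hO⟩ := exists_polynomial_isBigO F (s + 1)
    refine ⟨toGerm ℂ (γ.compFun G), ?_, ?_⟩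
    · rw [← γ.map_adjoin_coord]
      exact ⟨G, hG, rfl⟩
    have hg' : ordGerm (toGerm ℂ (γ.compFun F)) = s := hg
    have ht : Filter.Tendsto γ.n (𝓝 0) (𝓝 0) := by
      have := γ.analytic.continuousAt.tendsto
      rwa [γ.map_zero] at this
    have hn : γ.n =O[𝓝 0] fun t => ‖t‖ := by
      have := γ.analytic.differentiableAt.isBigO_sub
      simp only [γ.map_zero, sub_zero] at this
      exact this.norm_right
    have hlt : (s : ℕ∞) < ordGerm (toGerm ℂ (γ.compFun (F - G))) := by
      rw [ordGerm_mk]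
      refine lt_of_lt_of_le (show (s : ℕ∞) < (s + 1 : ℕ) by exact_mod_cast Nat.lt_succ_self s)
        (le_analyticOrderAt_of_isBigO (γ.compFun (F - G)).2 ?_)
      exact (hO.comp_tendsto ht).trans (hn.norm_left.pow (s + 1))
    have hGF : toGerm ℂ (γ.compFun G) =
        toGerm ℂ (γ.compFun F) + -1 * toGerm ℂ (γ.compFun (F - G)) := by
      rw [map_sub, map_sub]
      ring
    rw [hGF, ordGerm_add_of_lt, hg']
    rw [hg', ordGerm_mul]
    exact hlt.trans_le le_add_self
  · rintro ⟨g, hg, hs⟩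
    rw [← γ.map_adjoin_coord] at hg
    obtain ⟨G, -, rfl⟩ := hg
    exact ⟨toLocalRing C G, hs⟩

end Arc

theorem mem_adjoin_pair_iff (x y g : HolGerm ℂ) :
    g ∈ Algebra.adjoin ℂ {x, y} ↔ ∃ P, bieval x y P = g := by
  constructor
  · intro hg
    induction hg using Algebra.adjoin_induction with
    | mem z hz =>
      rcases hz with rfl | rfl
      · exact ⟨Polynomial.C Polynomial.X, by simp⟩
      · exact ⟨Polynomial.X, by simp⟩
    | algebraMap c => exact ⟨Polynomial.C (Polynomial.C c), by simp⟩
    | add a b _ _ ha hb =>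
      obtain ⟨P, rfl⟩ := ha
      obtain ⟨Q, rfl⟩ := hb
      exact ⟨P + Q, map_add _ _ _⟩
    | mul a b _ _ ha hb =>
      obtain ⟨P, rfl⟩ := ha
      obtain ⟨Q, rfl⟩ := hb
      exact ⟨P * Q, map_mul _ _ _⟩
  · rintro ⟨P, rfl⟩
    induction P using Polynomial.induction_on' with
    | add P Q hP hQ => rw [map_add]; exact add_mem hP hQ
    | monomial n p =>
      rw [← Polynomial.C_mul_X_pow_eq_monomial, map_mul, map_pow, bieval_X, bieval_C]
      refine mul_mem ?_ (pow_mem (Algebra.subset_adjoin (by simp)) n)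
      exact Algebra.adjoin_mono (by simp) (Polynomial.aeval_mem_adjoin_singleton ℂ x)

namespace Arc

variable {C : IrredGerm} (γ : Arc C)

/-! ## The semigroup of a normalization -/

/-- Birationality writes the parameter `t`, of order one, as a quotient `p / q` of functions on the
curve. -/
theorem exists_consecutive (hn : γ.IsNormalization) :
    ∃ d, d ∈ γ.semigroup ∧ d + 1 ∈ γ.semigroup := by
  obtain ⟨p, q, hq, hpq⟩ := hn.birational (toGerm ℂ ⟨id, analyticAt_id⟩)
  have h1 : ordGerm (toGerm ℂ ⟨id, analyticAt_id⟩) = 1 := analyticOrderAt_id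
  have hq' : ordGerm (γ.pullback q) ≠ ⊤ := fun h => hq ((ordGerm_eq_top_iff _).1 h)
  obtain ⟨d, hd⟩ := ENat.ne_top_iff_exists.1 hq'
  refine ⟨d, ⟨q, hd.symm⟩, ⟨p, ?_⟩⟩
  rw [val, ← hpq, ordGerm_mul, ← hd, h1]
  rfl

theorem exists_residue (hn : γ.IsNormalization) {m : ℕ} (hm : 0 < m) (r : ZMod m) :
    ∃ s ∈ γ.semigroup, (s : ZMod m) = r := by
  have : NeZero m := ⟨hm.ne'⟩
  obtain ⟨d, hd, hd'⟩ := γ.exists_consecutive hn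
  have hr := ZMod.val_lt r
  refine ⟨r.val • (d + 1) + (m - r.val) • d, add_mem (nsmul_mem hd' _) (nsmul_mem hd _), ?_⟩
  have : r.val • (d + 1) + (m - r.val) • d = r.val + m * d := by
    generalize r.val = i at hr
    obtain ⟨k, rfl⟩ := Nat.exists_eq_add_of_le hr.le
    rw [Nat.add_sub_cancel_left, smul_eq_mul, smul_eq_mul]
    ring
  rw [this]
  simp

/-- If a coordinate of the normalization has order one, then the curve is smooth. -/
theorem isSmooth_of_deriv_ne_zero (hinj : Function.Injective γ.pullback) (u v : ℂ × ℂ →L[ℂ] ℂ)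
    (e : ℂ × ℂ) (hu : u e = 0) (hv : v e = 1) (hd : deriv (fun t => u (γ.n t)) 0 ≠ 0) :
    C.IsSmooth := by
  intro hf
  have hun : AnalyticAt ℂ (fun t => u (γ.n t)) 0 := (u.analyticAt _).comp γ.analytic
  set r := hun.hasStrictDerivAt.localInverse _ _ _ hd
  have hra : AnalyticAt ℂ r 0 := by
    have := hun.analyticAt_localInverse hd
    simpa only [γ.map_zero, _root_.map_zero] using this
  have hleft : ∀ᶠ t in 𝓝 0, r (u (γ.n t)) = t :=
    HasStrictDerivAt.eventually_left_inverse hun.hasStrictDerivAt hd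
  have hr0 : r 0 = 0 := by
    have := hleft.self_of_nhds
    rwa [γ.map_zero, _root_.map_zero] at this
  -- The branch is the graph of `v` over `u`, with this function vanishing on it. By injectivity of
  -- the pullback it is a multiple of `f`, so its differential would vanish with that of `f`; along
  -- `e` its derivative is `1`.
  have hg : AnalyticAt ℂ (fun z => v z - v (γ.n (r (u z)))) 0 := by
    refine (v.analyticAt _).sub ((v.analyticAt _).comp (AnalyticAt.fun_comp_of_eq γ.analytic ?_ ?_))
    · exact AnalyticAt.fun_comp_of_eq hra (u.analyticAt _) (_root_.map_zero u)
    · rw [_root_.map_zero, hr0]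
  have hker : γ.pullback (toLocalRing C ⟨_, hg⟩) = 0 := by
    rw [pullback_toLocalRing, toGerm_eq_zero_iff]
    filter_upwards [hleft] with t ht
    change v (γ.n t) - v (γ.n (r (u (γ.n t)))) = 0
    rw [ht, sub_self]
  have hzero : toLocalRing C ⟨_, hg⟩ = 0 := hinj (hker.trans (_root_.map_zero _).symm)
  have hmem : toGerm (ℂ × ℂ) ⟨_, hg⟩ ∈ Ideal.span {germ C.f C.analytic} :=
    Ideal.Quotient.eq_zero_iff_mem.1 hzero
  obtain ⟨b, hb⟩ := Ideal.mem_span_singleton'.1 hmem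
  obtain ⟨h, rfl⟩ := toGerm_surjective _ b
  rw [germ, ← map_mul, toGerm_eq_iff] at hb
  have hf0 : C.f 0 = 0 := by
    have := γ.mem_curve.self_of_nhds
    rwa [γ.map_zero] at this
  have hC : HasFDerivAt C.f (0 : ℂ × ℂ →L[ℂ] ℂ) 0 := by
    have : HasFDerivAt C.f (fderiv ℂ C.f 0) 0 := C.analytic.differentiableAt.hasFDerivAt
    rwa [hf] at this
  have hprod : HasFDerivAt (fun z => h.1 z * C.f z) (0 : ℂ × ℂ →L[ℂ] ℂ) 0 := by
    have hh : AnalyticAt ℂ h.1 0 := h.2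
    have := hh.differentiableAt.hasFDerivAt.mul hC
    exact this.congr_fderiv (by ext <;> simp [hf0])
  have hgd : HasFDerivAt (fun z => v z - v (γ.n (r (u z)))) (0 : ℂ × ℂ →L[ℂ] ℂ) 0 :=
    hprod.congr_of_eventuallyEq (hb.mono fun z hz => hz.symm)
  have hline : HasDerivAt (fun s : ℂ => s • e) e 0 := by
    simpa using (hasDerivAt_id (0 : ℂ)).smul_const e
  have hcomp : HasDerivAt (fun s : ℂ => v (s • e) - v (γ.n (r (u (s • e))))) 0 0 := by
    have := HasFDerivAt.comp_hasDerivAt_of_eq (0 : ℂ) hgd hline (by simp)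
    rwa [zero_apply] at this
  have hid : (fun s : ℂ => v (s • e) - v (γ.n (r (u (s • e))))) = fun s => s := by
    funext s
    simp [hu, hv, hr0, γ.map_zero]
  rw [hid] at hcomp
  exact one_ne_zero ((hasDerivAt_id (0 : ℂ)).unique hcomp)

theorem ordGerm_toGerm_ne_one {f : ℂ → ℂ} (hf : AnalyticAt ℂ f 0) (hf0 : f 0 = 0)
    (hd : deriv f 0 = 0) : ordGerm (toGerm ℂ ⟨f, hf⟩) ≠ 1 := by
  rw [ordGerm_mk]
  intro h1
  have h2 := hf.analyticOrderAt_deriv_add_one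
  simp only [hf0, sub_zero] at h2
  change _ = analyticOrderAt f 0 at h2
  change analyticOrderAt f 0 = 1 at h1
  rw [h1] at h2
  have h3 : analyticOrderAt (deriv f) 0 ≠ 0 :=
    analyticOrderAt_ne_zero.2 ⟨hf.deriv, hd⟩
  have h4 : (1 : ℕ∞) ≤ analyticOrderAt (deriv f) 0 := Order.one_le_iff_ne_zero.2 h3
  have h5 : (1 : ℕ∞) + 1 ≤ 1 := by
    calc (1 : ℕ∞) + 1 ≤ analyticOrderAt (deriv f) 0 + 1 := by gcongr
      _ = 1 := h2
  exact absurd h5 (by decide)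

theorem one_lt_ordGerm {f : ℂ → ℂ} (hf : AnalyticAt ℂ f 0) (hf0 : f 0 = 0)
    (hd : deriv f 0 = 0) : 1 < ordGerm (toGerm ℂ ⟨f, hf⟩) := by
  refine lt_of_le_of_ne (Order.one_le_iff_ne_zero.2 ?_) (ordGerm_toGerm_ne_one hf hf0 hd).symm
  rw [ordGerm_mk]
  exact analyticOrderAt_ne_zero.2 ⟨hf, hf0⟩

theorem one_lt_ordGerm_coord (hn : γ.IsNormalization) (hC : ¬ C.IsSmooth) :
    1 < ordGerm γ.xGerm ∧ 1 < ordGerm γ.yGerm := by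
  have hx : deriv (fun t => (γ.n t).1) 0 = 0 := by
    by_contra hd
    exact hC (γ.isSmooth_of_deriv_ne_zero hn.injective (.fst ℂ ℂ ℂ) (.snd ℂ ℂ ℂ) (0, 1)
      rfl rfl hd)
  have hy : deriv (fun t => (γ.n t).2) 0 = 0 := by
    by_contra hd
    exact hC (γ.isSmooth_of_deriv_ne_zero hn.injective (.snd ℂ ℂ ℂ) (.fst ℂ ℂ ℂ) (1, 0)
      rfl rfl hd)
  exact ⟨one_lt_ordGerm (γ.compFun coordFst).2 (congrArg Prod.fst γ.map_zero) hx,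
    one_lt_ordGerm (γ.compFun coordSnd).2 (congrArg Prod.snd γ.map_zero) hy⟩

/-- The coordinate of smaller order plays the role of `x`. Its order exceeds one by non-smoothness,
and consecutive values provide all residue classes. -/
theorem exists_isAperySeq (hn : γ.IsNormalization) (hC : ¬ C.IsSmooth) :
    ∃ m a, IsAperySeq γ.semigroup m a := by
  obtain ⟨hx, hy⟩ := γ.one_lt_ordGerm_coord hn hC
  have hmem := γ.mem_semigroup_iff_adjoin
  have hfin : min (ordGerm γ.xGerm) (ordGerm γ.yGerm) ≠ ⊤ := by
    intro htop
    rw [min_eq_top, ordGerm_eq_top_iff, ordGerm_eq_top_iff] at htop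
    rw [htop.1, htop.2] at hmem
    -- If both coordinates vanish, only constants contribute values.
    have h0 : ∀ s ∈ γ.semigroup, s = 0 := by
      intro s hs
      obtain ⟨g, hg, hgs⟩ := (hmem s).1 hs
      rw [Set.pair_eq_singleton, Algebra.adjoin_singleton_zero, Algebra.mem_bot] at hg
      obtain ⟨c, rfl⟩ := hg
      by_cases hc : c = 0
      · rw [hc, _root_.map_zero, ordGerm_zero] at hgs
        exact absurd hgs.symm (ENat.natCast_ne_top s)
      · rw [ordGerm_algebraMap hc] at hgs
        exact_mod_cast hgs.symm
    obtain ⟨d, -, hd⟩ := γ.exists_consecutive hn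
    exact absurd (h0 _ hd) (by omega)
  obtain ⟨m, hm⟩ := ENat.ne_top_iff_exists.1 hfin
  have hm1 : 1 < m := by
    have : (1 : ℕ∞) < m := hm ▸ lt_min hx hy
    exact_mod_cast this
  have hres := γ.exists_residue hn (m := m) (by omega)
  rcases le_total (ordGerm γ.xGerm) (ordGerm γ.yGerm) with hle | hle
  · rw [min_eq_left hle] at hm
    obtain ⟨a, ha⟩ := PlaneCurve.exists_isAperySeq (x := γ.xGerm) (y := γ.yGerm)
      (S := γ.semigroup) (fun s => by
        simp only [hmem s, mem_adjoin_pair_iff, exists_exists_eq_and])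
      hm1 hm.symm (hm ▸ hle) hres
    exact ⟨m, a, ha⟩
  · rw [min_eq_right hle] at hm
    obtain ⟨a, ha⟩ := PlaneCurve.exists_isAperySeq (x := γ.yGerm) (y := γ.xGerm)
      (S := γ.semigroup) (fun s => by
        simp only [hmem s, Set.pair_comm γ.xGerm, mem_adjoin_pair_iff, exists_exists_eq_and])
      hm1 hm.symm (hm ▸ hle) hres
    exact ⟨m, a, ha⟩

/-! ## The Hilbert function -/

theorem mem_filtration {l : ℕ} {g : C.LocalRing} : g ∈ γ.filtration l ↔ (l : ℕ∞) ≤ γ.val g :=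
  Iff.rfl

theorem filtration_succ_le (l : ℕ) : γ.filtration (l + 1) ≤ γ.filtration l := fun g hg =>
  le_trans (by exact_mod_cast Nat.le_succ l) (γ.mem_filtration.1 hg)

theorem filtration_succ_eq {l : ℕ} (hl : l ∉ γ.semigroup) :
    γ.filtration (l + 1) = γ.filtration l := by
  refine le_antisymm (γ.filtration_succ_le l) fun g hg => ?_
  rw [mem_filtration] at hg ⊢
  have hlt : (l : ℕ∞) < γ.val g := lt_of_le_of_ne hg fun he => hl ⟨g, he.symm⟩
  rw [Nat.cast_succ]
  exact Order.add_one_le_of_lt hlt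

/-- Two functions of value `l` are proportional up to higher order, so the kernel of the projection
between the quotients is the line spanned by one of them. -/
theorem finite_and_finrank_succ {l : ℕ} (hl : l ∈ γ.semigroup)
    (hfin : Module.Finite ℂ (C.LocalRing ⧸ γ.filtration l)) :
    Module.Finite ℂ (C.LocalRing ⧸ γ.filtration (l + 1)) ∧
      γ.hilbert (l + 1) = γ.hilbert l + 1 := by
  obtain ⟨g, hg⟩ := hl
  let φ : (C.LocalRing ⧸ γ.filtration (l + 1)) →ₗ[ℂ] (C.LocalRing ⧸ γ.filtration l) :=
    (Ideal.quotientMapₐ (γ.filtration l) (AlgHom.id ℂ C.LocalRing)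
      (γ.filtration_succ_le l)).toLinearMap
  have hφ : ∀ a, φ (Ideal.Quotient.mkₐ ℂ _ a) = Ideal.Quotient.mkₐ ℂ _ a := fun a => rfl
  have hsurj : Function.Surjective φ := by
    intro b
    obtain ⟨a, rfl⟩ := Ideal.Quotient.mkₐ_surjective ℂ _ b
    exact ⟨_, hφ a⟩
  have hv0 : Ideal.Quotient.mkₐ ℂ (γ.filtration (l + 1)) g ≠ 0 := by
    intro h0
    have h1 := γ.mem_filtration.1 (Ideal.Quotient.eq_zero_iff_mem.1 h0)
    rw [hg] at h1
    have h2 : l + 1 ≤ l := by exact_mod_cast h1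
    omega
  have hker : LinearMap.ker φ = Submodule.span ℂ {Ideal.Quotient.mkₐ ℂ (γ.filtration (l + 1)) g} := by
    refine le_antisymm (fun w hw => ?_) ?_
    · obtain ⟨h, rfl⟩ := Ideal.Quotient.mkₐ_surjective ℂ _ w
      rw [LinearMap.mem_ker, hφ] at hw
      have hl' := γ.mem_filtration.1 (Ideal.Quotient.eq_zero_iff_mem.1 hw)
      rw [Submodule.mem_span_singleton]
      rcases hl'.eq_or_lt with he | hlt
      · obtain ⟨c, hc⟩ := exists_lt_ordGerm_sub (a := γ.pullback h) (b := γ.pullback g) he.symm hg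
        refine ⟨c, ?_⟩
        rw [← map_smul]
        refine (Ideal.Quotient.eq.2 ?_).symm
        rw [mem_filtration, val, map_sub, map_smul, Algebra.smul_def, Nat.cast_succ]
        exact Order.add_one_le_of_lt hc
      · refine ⟨0, ?_⟩
        rw [zero_smul]
        refine (Ideal.Quotient.eq_zero_iff_mem.2 ?_).symm
        rw [mem_filtration, Nat.cast_succ]
        exact Order.add_one_le_of_lt hlt
    · rw [Submodule.span_singleton_le_iff_mem, LinearMap.mem_ker, hφ]
      exact Ideal.Quotient.eq_zero_iff_mem.2 (γ.mem_filtration.2 hg.ge)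
  have hkfin : Module.Finite ℂ (LinearMap.ker φ) := by
    rw [hker]
    infer_instance
  have hqfin : Module.Finite ℂ ((C.LocalRing ⧸ γ.filtration (l + 1)) ⧸ LinearMap.ker φ) :=
    Module.Finite.equiv (φ.quotKerEquivOfSurjective hsurj).symm
  have hfin' : Module.Finite ℂ (C.LocalRing ⧸ γ.filtration (l + 1)) :=
    Module.Finite.of_submodule_quotient (LinearMap.ker φ)
  refine ⟨hfin', ?_⟩
  have h1 := φ.finrank_range_add_finrank_ker
  rw [LinearMap.range_eq_top.2 hsurj, finrank_top, hker, finrank_span_singleton hv0] at h1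
  exact h1.symm

theorem finite_quotient (l : ℕ) : Module.Finite ℂ (C.LocalRing ⧸ γ.filtration l) := by
  induction l with
  | zero =>
    have : Subsingleton (C.LocalRing ⧸ γ.filtration 0) := by
      rw [Ideal.Quotient.subsingleton_iff, Ideal.eq_top_iff_one, mem_filtration]
      simp
    infer_instance
  | succ l ih =>
    by_cases hl : l ∈ γ.semigroup
    · exact (γ.finite_and_finrank_succ hl ih).1
    · rw [γ.filtration_succ_eq hl]
      exact ih

theorem isWeight_w0 : IsWeight γ.semigroup γ.w0 where
  zero := by
    have : Subsingleton (C.LocalRing ⧸ γ.filtration 0) := by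
      rw [Ideal.Quotient.subsingleton_iff, Ideal.eq_top_iff_one, mem_filtration]
      simp
    simp [w0, hilbert, Module.finrank_zero_of_subsingleton]
  succ_of_mem l hl := by
    rw [w0, w0, (γ.finite_and_finrank_succ hl (γ.finite_quotient l)).2]
    push_cast
    ring
  succ_of_notMem l hl := by
    rw [w0, w0, hilbert, hilbert, γ.filtration_succ_eq hl]
    push_cast
    ring

end Arc

/-! ## The equivalences -/

/-- If the gcd of the generators before the last one is not `2`, then both lattice conditions
fail. -/
theorem not_of_gcdBeta_ne_two {S : AddSubmonoid ℕ} {m : ℕ} {a : ℕ → ℕ} {D : ℕ} {w : ℕ → ℤ}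
    (h : IsAperySeq S m a) (hD : IsLastIndec m a D) (hw : IsWeight S w) (he : m / D ≠ 2) :
    ¬ OddRanksOne w ∧ ¬ RootEvenTrimmedPath w := by
  classical
  have hex : ∃ s, s ∈ S ∧ Odd s := by
    obtain ⟨s, hs, ho, -⟩ := h.exists_odd_le hD
    exact ⟨s, hs, ho⟩
  obtain ⟨hs, ho⟩ := Nat.find_spec hex
  have hmin : ∀ t ∈ S, Odd t → Nat.find hex ≤ t := fun t ht hto => Nat.find_min' hex ⟨ht, hto⟩
  generalize Nat.find hex = s at hs ho hmin
  have hs0 := ho.pos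
  -- A gap before the least odd element `s` makes `s` an odd valley; otherwise two consecutive
  -- ascents start at `s - 1`.
  by_cases hpred : s - 1 ∈ S
  swap
  · exact hw.not_of_odd_valley ho hs hpred
  have hsD : s ≤ a D := by
    obtain ⟨t, ht, hto, htD⟩ := h.exists_odd_le hD
    exact (hmin t ht hto).trans htD
  rcases h.two_mul_lastIndec_lt hD he with hlt | rfl
  · have h1 := hw.succ_of_mem _ hpred
    rw [Nat.sub_add_cancel hs0] at h1
    have h2 := hw.succ_of_mem s hs
    -- The second valley is the mirror image of `s - 1`; it lies beyond `s + 1` because `2 * s ≤ 2 *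
    -- a D` is less than the conductor.
    refine hw.not_of_separated (hw.bddBelow fun x => h.mem_of_conductor_le) (p := s - 1)
      (r := s + 1) (q := IsAperySeq.conductor m a - (s - 1)) (Nat.Odd.sub_odd ho odd_one)
      (by omega) (by omega) (hw.symm (fun x y => h.mem_iff_notMem) (by omega)) (by omega)
  -- For `m = 3` the least odd element is `3`, and `2` is a gap.
  · exfalso
    have h3 := hmin 3 h.mult_mem (by decide)
    have h4 := h.mult_le_of_mem hs (by omega)
    have h5 := h.mult_le_of_mem hpred (by omega)
    omega

end PlaneCurve

end

theorem mainTheorem5 (C : PlaneCurve.IrredGerm) (n : PlaneCurve.Arc C)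
    (hn : n.IsNormalization) (hC : ¬ C.IsSmooth) :
    [ PlaneCurve.gcdBeta n.semigroup (PlaneCurve.lastIndex n.semigroup - 1) = 2,
      PlaneCurve.OddRanksOne n.w0,
      PlaneCurve.RootEvenTrimmedPath n.w0,
      PlaneCurve.delta n.semigroup
          < PlaneCurve.beta n.semigroup (PlaneCurve.lastIndex n.semigroup) ∧
        PlaneCurve.multiplicity n.semigroup ≠ 3 ].TFAE ∧
    (PlaneCurve.OddRanksOne n.w0 →
      LinearMap.range (PlaneCurve.actU n.w0) ≤ PlaneCurve.towerSubmodule n.w0 ∧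
      ∀ (d : ℤ) (a : PlaneCurve.H0 n.w0 d), a ≠ 0 →
        PlaneCurve.actU n.w0 (PlaneCurve.homog n.w0 d a) = 0 → Even d) := by
  refine ⟨?_, fun h => ⟨h.range_actU_le, h.even_of_actU_eq_zero⟩⟩
  obtain ⟨m, a, h⟩ := n.exists_isAperySeq hn hC
  obtain ⟨D, hD⟩ := h.exists_isLastIndec
  have hw := n.isWeight_w0
  have hdelta := h.two_mul_delta
  rw [h.gcdBeta_eq hD, h.beta_lastIndex_eq hD, h.multiplicity_eq]
  tfae_have 1 → 2 := fun he => by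
    obtain ⟨hb, hodd, heven, -⟩ := h.even_odd_structure hD he
    exact hw.oddRanksOne hb hodd heven
  tfae_have 1 → 3 := fun he => by
    obtain ⟨hb, hodd, heven, -⟩ := h.even_odd_structure hD he
    exact hw.rootEvenTrimmedPath hb hodd heven
  tfae_have 1 → 4 := fun he => by
    obtain ⟨-, -, -, hlt, hm⟩ := h.even_odd_structure hD he
    exact ⟨by omega, hm⟩
  tfae_have 2 → 1 := fun h2 => by
    by_contra he
    exact (PlaneCurve.not_of_gcdBeta_ne_two h hD hw he).1 h2
  tfae_have 3 → 1 := fun h3 => by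
    by_contra he
    exact (PlaneCurve.not_of_gcdBeta_ne_two h hD hw he).2 h3
  -- Since the conductor is `2δ`, the inequality `δ < β_g` excludes `2β_g < c`, and `m ≠ 3` excludes
  -- the remaining case.
  tfae_have 4 → 1 := by
    rintro ⟨h4, hm⟩
    by_contra he
    rcases h.two_mul_lastIndec_lt hD he with hlt | hm3
    · omega
    · exact hm hm3
  tfae_finish
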